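/- Let $0<a<1$ and $b\in\mathbb R$, and write $\mathbb U_R=\{z\in\mathbb C:|z|<R\}$, $\mathbb U=\mathbb U_1$. All powers of $z$ are principal, $\arg z\in(-\pi,\pi]$. Let $f(x,y)$ be a real function on $[0,1]\times\mathbb R$ (its values at $x=0$ play no role), and suppose that it has an analytic continuation $f(z,t)$, that is, $f(z,t)$ takes the values $f(x,y)$ for $z=x\in(0,1]$, $t=y\in\mathbb R$ (so there $f(x,y)=\Re f(z,t)$), such that: (I) $f(z,t)$ is analytic on $(\mathbb U\setminus(-1,0])\times\mathbb C$ and continuous on $(\overline{\mathbb U}\setminus[-1,0])\times\mathbb C$, and $z^a f(z,t)$ extends over $z=0$ to a function analytic on $\mathbb U\times\mathbb C$ and continuous on $\overline{\mathbb U}\times\mathbb C$; (3.9) there are an integer $n_0\ge 1$, a real $c\ge 0$ and a function $g$, analytic on $\mathbb U$, continuous on $\overline{\mathbb U}$, with $g(0)=0$, such that $$\Bigl|z^a\Bigl(f(z,t)-\frac{b}{\Gamma(1-a)}z^{-a}\Bigr)\Bigr|\le c\,|t-b|^{n_0}+|g(z)|\qquad(z\in\overline{\mathbb U}\setminus\{0\},\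 t\in\mathbb C).$$ Then there is $R_0\in(0,1]$ such that the real problem $$\mathcal D^a u(x)=\frac{1}{\Gamma(1-a)}\frac{d}{dx}\int_0^x\frac{u(s)}{(x-s)^a}\,ds=f(x,u(x))\quad(0<x\le R_0),\qquad u(0)=b,$$ with the Riemann–Liouville derivative (one-sided derivative at $x=R_0$) has at least one solution continuous on $[0,R_0]$. Moreover, this solution can be taken to be the restriction to $[0,R_0]$ of the real part of a solution $u(z)$ of the complex problem $$D_z^a u(z)=\frac1{\Gamma(1-a)}\frac{d}{dz}\int_0^z\frac{u(\zeta)}{(z-\zeta)^a}\,d\zeta=f(z,u(z)),\qquad u(0)=b,$$ on the cut disc $\mathbb U_{R_0}\setminus(-R_0,0]$ (the integral is along the segment from $0$ to $z$, with $\arg(z-\zeta)=\arg z$), where $u$ is analytic on the cut disc and continuous on $(\overline{\mathbb U}_{R_0}\setminus[-R_0,0])\cup\{0\}$. If in addition $n_0\ge2$ or $c\,\Gamma(2-a)<1$, then $u$ can be taken analytic on the whole disc $\mathbb U_{R_0}$ and continuous on $\overline{\mathbb U}_{R_0}$. -/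

import Mathlib

/-- The open disc of radius `R` about `0`, cut along the non-positive real axis. -/
def cutDisc (R : ℝ) : Set ℂ := Metric.ball 0 R ∩ Complex.slitPlane

/-- The closed disc of radius `R` about `0`, cut along the non-positive real axis. -/
def closedCutDisc (R : ℝ) : Set ℂ := Metric.closedBall 0 R ∩ Complex.slitPlane

/-- The regularity condition on the right-hand side `F(z,t)`: it is analytic on the cut disc times
`ℂ` and continuous on the closed cut disc times `ℂ`, and `z ^ a * F(z,t)` (principal power)
extends over `z = 0` to a function `G` that is analytic on the full open unit disc times `ℂ` and
continuous on the closed unit disc times `ℂ`. On the negative real axis, where the principal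
argument is `π`, the identity with `G` gives the continuity of `F` from above, which is all that
a branch like `z ^ (-a)` can have there. -/
structure RegularRHS (a : ℝ) (F : ℂ → ℂ → ℂ) : Prop where
  analytic : AnalyticOnNhd ℂ (fun p : ℂ × ℂ => F p.1 p.2) (cutDisc 1 ×ˢ Set.univ)
  continuous : ContinuousOn (fun p : ℂ × ℂ => F p.1 p.2) (closedCutDisc 1 ×ˢ Set.univ)
  extension : ∃ G : ℂ × ℂ → ℂ,
    AnalyticOnNhd ℂ G (Metric.ball 0 1 ×ˢ Set.univ) ∧
    ContinuousOn G (Metric.closedBall 0 1 ×ˢ Set.univ) ∧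
    ∀ z ∈ Metric.closedBall (0 : ℂ) 1, z ≠ 0 → ∀ t : ℂ, G (z, t) = z ^ (a : ℂ) * F z t

/-- Membership in the space of functions analytic on the open disc of radius `R` about `0` and
continuous on the closed disc. -/
def MemDiscSpace (R : ℝ) (u : ℂ → ℂ) : Prop := DiffContOnCl ℂ u (Metric.ball 0 R)

/-- The growth condition `|z^a h(z,t)| ≤ c |t - b|^n + |g(z)|` for
`h(z,t) = f(z,t) - b z^(-a) / Γ(1 - a)`, on the closed unit disc without its centre
(at the centre it then holds for the continuous extension). -/
def GrowthBound (a b : ℝ) (F : ℂ → ℂ → ℂ) (n : ℕ) (c : ℝ) (g : ℂ → ℂ) : Prop :=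
  ∀ z ∈ Metric.closedBall (0 : ℂ) 1, z ≠ 0 → ∀ t : ℂ,
    ‖z ^ (a : ℂ) * (F z t - ((b / Real.Gamma (1 - a) : ℝ) : ℂ) * z ^ (-(a : ℂ)))‖
      ≤ c * ‖t - (b : ℂ)‖ ^ n + ‖g z‖

/-- The complex fractional integral of order `1 - a`,
`(1 / Γ(1 - a)) ∫_0^z u(ζ) (z - ζ)^(-a) dζ`, along the segment `ζ = s z`, `0 ≤ s ≤ 1`. As
`z - s z = (1 - s) z` has the argument of `z`, the principal power is
`|z - ζ|^(-a) exp(-i a arg z)`. -/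
noncomputable def complexFracIntegral (a : ℝ) (u : ℂ → ℂ) (z : ℂ) : ℂ :=
  (1 / Real.Gamma (1 - a) : ℝ) *
    ∫ s in (0 : ℝ)..1, u ((s : ℂ) * z) * (z - (s : ℂ) * z) ^ (-(a : ℂ)) * z

/-- The real Riemann-Liouville integral of order `1 - a`,
`(1 / Γ(1 - a)) ∫_0^x u(s) (x - s)^(-a) ds`. -/
noncomputable def realFracIntegral (a : ℝ) (u : ℝ → ℝ) (x : ℝ) : ℝ :=
  (1 / Real.Gamma (1 - a)) * ∫ s in (0 : ℝ)..x, u s / (x - s) ^ a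

/-- `u` is a solution of the complex problem `D_z^a u(z) = F(z,u(z))`, `u(0) = b` on the cut disc
of radius `R`: it is analytic there, continuous on the closed cut disc together with the centre,
and its fractional derivative, i.e. the derivative of its fractional integral of order `1 - a`,
exists and is `F(z,u(z))` at every point of the cut disc. -/
structure IsComplexSolution (a : ℝ) (b : ℂ) (F : ℂ → ℂ → ℂ) (R : ℝ) (u : ℂ → ℂ) : Prop where
  analytic : DifferentiableOn ℂ u (cutDisc R)
  continuous : ContinuousOn u (insert 0 (closedCutDisc R))
  initial : u 0 = b
  equation : ∀ z ∈ cutDisc R, HasDerivAt (complexFracIntegral a u) (F z (u z)) z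

/-- `u` is a continuous solution on `[0,R]` of the real problem `D^a u(x) = f(x,u(x))`,
`u(0) = b`, with the Riemann-Liouville derivative; the equation holds on `(0,R]` (with the
one-sided derivative at `R`). -/
structure IsRealSolution (a b : ℝ) (f : ℝ → ℝ → ℝ) (R : ℝ) (u : ℝ → ℝ) : Prop where
  continuous : ContinuousOn u (Set.Icc 0 R)
  initial : u 0 = b
  equation : ∀ x ∈ Set.Ioc 0 R,
    HasDerivWithinAt (realFracIntegral a u) (f x (u x)) (Set.Icc 0 R) x

open Real Set Filter Topology MeasureTheory

/-! Abel's inversion turns the problem into a fixed point equation. With `φ(z) = z^a F(z,u(z))` it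
reads `u = Aφ`, where `Aφ(z) = ∫₀¹ k(s) φ(sz) ds` and `k(s) = s^(-a) (1-s)^(a-1) / Γ(a)`. The
singular factor has disappeared: `A` maps `z^σ` to `Λ_σ z^σ` with `Λ_σ = Γ(σ+1-a)/Γ(σ+1)`. Since
`Λ_0 = Γ(1-a)`, the constant `b/Γ(1-a)` goes to `b`, and for `u = b + w` there remains `w = A
N(·,w)`, where `N` is analytic near the centre and `N(0,0) = 0`.

The numbers `Λ_σ` decrease strictly, and along the integers tend to `0`. If `N` has Lipschitz
constant `L` in its second variable, then on functions of size `O(|z|^σ)` the map contracts by the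
factor `L Λ_σ`. So an approximate solution whose residual has order `σ` with `L Λ_σ < 1` can be
corrected to a solution (`exists_eq_weightedMean`).

If `n₀ ≥ 2` or `c Γ(2-a) < 1`, order `1` is enough, because `Λ_1 = Γ(2-a)`; the iteration starts at
`0` and stays analytic in the full disc. Otherwise `n₀ = 1`, and Liouville's theorem forces `N(z,t)
= p(z) + q(z) t`. The residual is then removed power by power, which requires dividing by `1 - q(0)
Λ_j`. If this vanishes for some `j`, a term `z^j log z` takes over, which is why only the cut disc
is reached. Past that order the contraction condition holds automatically
(`exists_approximate_solution`).

All functions involved are real on `(0,R]`, so the complex solution restricts to a real one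
(`isSolution_of_eq_weightedMean`). -/

/-! ### Beta integrals, the Abel kernel and its moments. -/

theorem intervalIntegrable_rpow_mul_one_sub_rpow {u v : ℝ} (hu : 0 < u) (hv : 0 < v) :
    IntervalIntegrable (fun x : ℝ => x ^ (u - 1) * (1 - x) ^ (v - 1)) volume 0 1 := by
  have h := Complex.betaIntegral_convergent (u := (u : ℂ)) (v := (v : ℂ)) (by simpa) (by simpa)
  rw [intervalIntegrable_iff, uIoc_of_le zero_le_one] at h ⊢
  have h' : IntegrableOn (fun x : ℝ =>
      ((x : ℂ) ^ ((u : ℂ) - 1) * (1 - (x : ℂ)) ^ ((v : ℂ) - 1)).re) (Ioc 0 1) := h.re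
  refine h'.congr_fun (fun x hx => ?_) measurableSet_Ioc
  have h1 : 0 ≤ 1 - x := by linarith [hx.2]
  have : (x : ℂ) ^ ((u : ℂ) - 1) * (1 - (x : ℂ)) ^ ((v : ℂ) - 1)
      = ((x ^ (u - 1) * (1 - x) ^ (v - 1) : ℝ) : ℂ) := by
    rw [Complex.ofReal_mul, Complex.ofReal_cpow hx.1.le, Complex.ofReal_cpow h1]
    push_cast; rfl
  simp only [this, Complex.ofReal_re]

theorem integral_rpow_mul_one_sub_rpow {u v : ℝ} (hu : 0 < u) (hv : 0 < v) :
    ∫ x in (0 : ℝ)..1, x ^ (u - 1) * (1 - x) ^ (v - 1) = Gamma u * Gamma v / Gamma (u + v) := by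
  have h := Complex.betaIntegral_eq_Gamma_mul_div (u : ℂ) (v : ℂ) (by simpa) (by simpa)
  apply Complex.ofReal_injective
  rw [← intervalIntegral.integral_ofReal]
  push_cast
  rw [← Complex.Gamma_ofReal, ← Complex.Gamma_ofReal, ← Complex.Gamma_ofReal, Complex.ofReal_add,
    ← h, Complex.betaIntegral]
  refine intervalIntegral.integral_congr fun x hx => ?_
  rw [uIcc_of_le zero_le_one] at hx
  have h1 : 0 ≤ 1 - x := by linarith [hx.2]
  rw [Complex.ofReal_cpow hx.1, Complex.ofReal_cpow h1]
  push_cast; rfl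

/-- The kernel of the inverse of `u ↦ z ^ a * D_z^a u` in multiplicative form. -/
noncomputable def abelKernel (a s : ℝ) : ℝ := s ^ (-a) * (1 - s) ^ (a - 1) / Gamma a

/-- The moments of `abelKernel`. -/
noncomputable def abelMoment (a σ : ℝ) : ℝ := ∫ s in (0 : ℝ)..1, abelKernel a s * s ^ σ

section

variable {a : ℝ}

theorem intervalIntegrable_abelKernel (ha₀ : 0 < a) (ha₁ : a < 1) :
    IntervalIntegrable (abelKernel a) volume 0 1 := by
  have h := intervalIntegrable_rpow_mul_one_sub_rpow (u := 1 - a) (v := a) (by linarith) ha₀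
  simp only [sub_sub_cancel_left] at h
  exact h.div_const (Gamma a)

theorem abelKernel_nonneg (ha₀ : 0 < a) {s : ℝ} (hs : s ∈ Icc (0 : ℝ) 1) :
    0 ≤ abelKernel a s := by
  have := Gamma_pos_of_pos ha₀
  have h1 : 0 ≤ 1 - s := by linarith [hs.2]
  have h0 := hs.1
  unfold abelKernel; positivity

theorem abelKernel_pos (ha₀ : 0 < a) {s : ℝ} (hs : s ∈ Ioo (0 : ℝ) 1) :
    0 < abelKernel a s := by
  have := Gamma_pos_of_pos ha₀
  have h1 : 0 < 1 - s := by linarith [hs.2]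
  have h0 := hs.1
  unfold abelKernel; positivity

theorem IntervalIntegrable.mul_of_bounded {k f : ℝ → ℝ} (hk : IntervalIntegrable k volume 0 1)
    {M : ℝ} (hf : ContinuousOn f (Ioc 0 1)) (hM : ∀ s ∈ Ioc (0 : ℝ) 1, |f s| ≤ M) :
    IntervalIntegrable (fun s => k s * f s) volume 0 1 := by
  rw [intervalIntegrable_iff, uIoc_of_le zero_le_one] at hk ⊢
  refine Integrable.mul_bdd (c := M) hk (hf.aestronglyMeasurable measurableSet_Ioc) ?_
  filter_upwards [ae_restrict_mem measurableSet_Ioc] with s hs using hM s hs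

theorem intervalIntegrable_abelKernel_mul_rpow (ha₀ : 0 < a) (ha₁ : a < 1) {σ : ℝ} (hσ : 0 ≤ σ) :
    IntervalIntegrable (fun s => abelKernel a s * s ^ σ) volume 0 1 := by
  refine (intervalIntegrable_abelKernel ha₀ ha₁).mul_of_bounded (M := 1)
    (continuousOn_id.rpow_const fun s hs => Or.inr hσ) fun s hs => ?_
  rw [abs_of_nonneg (rpow_nonneg hs.1.le _)]
  exact rpow_le_one hs.1.le hs.2 hσ

/-- This is the Beta integral `B(σ+1-a, a)`, whose factor `Γ(a)` cancels the normalisation of the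
kernel. -/
theorem abelMoment_eq (ha₀ : 0 < a) (ha₁ : a < 1) {σ : ℝ} (hσ : 0 ≤ σ) :
    abelMoment a σ = Gamma (σ + 1 - a) / Gamma (σ + 1) := by
  have h := integral_rpow_mul_one_sub_rpow (u := σ + 1 - a) (v := a) (by linarith) ha₀
  have hG := (Gamma_pos_of_pos ha₀).ne'
  have : abelMoment a σ
      = ∫ x in (0 : ℝ)..1, x ^ (σ + 1 - a - 1) * (1 - x) ^ (a - 1) / Gamma a := by
    unfold abelMoment abelKernel
    rw [intervalIntegral.integral_of_le zero_le_one, intervalIntegral.integral_of_le zero_le_one]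
    refine setIntegral_congr_fun measurableSet_Ioc fun s hs => ?_
    rw [show σ + 1 - a - 1 = -a + σ by ring, rpow_add hs.1]
    ring
  rw [this, intervalIntegral.integral_div, h]
  rw [show σ + 1 - a + a = σ + 1 by ring]
  field_simp

theorem abelMoment_zero (ha₀ : 0 < a) (ha₁ : a < 1) : abelMoment a 0 = Gamma (1 - a) := by
  rw [abelMoment_eq ha₀ ha₁ le_rfl]; simp

/-- The source of the constant `Γ(2-a)` in the analyticity criterion: it is the gain of the mean on
functions of order `1`. -/
theorem abelMoment_one (ha₀ : 0 < a) (ha₁ : a < 1) : abelMoment a 1 = Gamma (2 - a) := by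
  rw [abelMoment_eq ha₀ ha₁ zero_le_one]
  norm_num

theorem abelMoment_pos (ha₀ : 0 < a) (ha₁ : a < 1) {σ : ℝ} (hσ : 0 ≤ σ) : 0 < abelMoment a σ := by
  rw [abelMoment_eq ha₀ ha₁ hσ]
  have h1 := Gamma_pos_of_pos (show 0 < σ + 1 - a by linarith)
  have h2 := Gamma_pos_of_pos (show 0 < σ + 1 by linarith)
  positivity

/-- On `(0,1)` the powers `s^σ` decrease strictly in `σ`. Hence resonance occurs at one order at
most, and every order beyond it contracts. -/
theorem abelMoment_lt (ha₀ : 0 < a) (ha₁ : a < 1) {σ τ : ℝ} (hσ : 0 ≤ σ) (h : σ < τ) :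
    abelMoment a τ < abelMoment a σ := by
  have i1 := intervalIntegrable_abelKernel_mul_rpow ha₀ ha₁ hσ
  have i2 := intervalIntegrable_abelKernel_mul_rpow ha₀ ha₁ (hσ.trans h.le)
  rw [← sub_pos, abelMoment, abelMoment, ← intervalIntegral.integral_sub i1 i2]
  refine intervalIntegral.intervalIntegral_pos_of_pos_on (i1.sub i2) (fun s hs => ?_) zero_lt_one
  have := rpow_lt_rpow_of_exponent_gt hs.1 hs.2 h
  have hk := abelKernel_pos ha₀ hs
  nlinarith

/-- Dominated convergence with the kernel itself as majorant. However large `q(0)` is, a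
sufficiently high order contracts. -/
theorem tendsto_abelMoment (ha₀ : 0 < a) (ha₁ : a < 1) :
    Tendsto (fun n : ℕ => abelMoment a n) atTop (𝓝 0) := by
  have : Tendsto (fun n : ℕ => ∫ s in (0 : ℝ)..1, abelKernel a s * s ^ (n : ℝ)) atTop
      (𝓝 (∫ _ in (0 : ℝ)..1, (0 : ℝ))) := by
    refine intervalIntegral.tendsto_integral_filter_of_dominated_convergence (abelKernel a)
      (Eventually.of_forall fun n => ?_) (Eventually.of_forall fun n => ?_)
      (intervalIntegrable_abelKernel ha₀ ha₁) ?_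
    · have := intervalIntegrable_abelKernel_mul_rpow ha₀ ha₁ (Nat.cast_nonneg (α := ℝ) n)
      rw [intervalIntegrable_iff] at this
      exact this.aestronglyMeasurable
    · refine Eventually.of_forall fun s hs => ?_
      rw [uIoc_of_le zero_le_one] at hs
      have h1 := abelKernel_nonneg ha₀ (Ioc_subset_Icc_self hs)
      have h2 := rpow_nonneg hs.1.le (n : ℝ)
      rw [norm_of_nonneg (mul_nonneg h1 h2)]
      exact mul_le_of_le_one_right h1 (rpow_le_one hs.1.le hs.2 (Nat.cast_nonneg n))
    · have h1 : ∀ᵐ s : ℝ, s ≠ 1 := by simp [ae_iff, measure_singleton]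
      filter_upwards [h1] with s hs1 hs
      rw [uIoc_of_le zero_le_one] at hs
      have := tendsto_pow_atTop_nhds_zero_of_lt_one hs.1.le (lt_of_le_of_ne hs.2 hs1)
      simpa using this.const_mul (abelKernel a s)
  simpa [abelMoment] using this

/-- The logarithmic moments of `abelKernel` are negative. -/
theorem integral_abelKernel_mul_pow_mul_log_neg (ha₀ : 0 < a)
    {k : ℕ} (hi : IntervalIntegrable (fun s => abelKernel a s * (s ^ k * log s)) volume 0 1) :
    ∫ s in (0 : ℝ)..1, abelKernel a s * (s ^ k * log s) < 0 := by
  rw [← neg_pos, ← intervalIntegral.integral_neg]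
  refine intervalIntegral.intervalIntegral_pos_of_pos_on hi.neg (fun s hs => ?_) zero_lt_one
  have h1 := abelKernel_pos ha₀ hs
  have h2 := log_neg hs.1 hs.2
  have h3 := pow_pos hs.1 k
  have : 0 < abelKernel a s * (s ^ k * -log s) := by
    have : 0 < -log s := by linarith
    positivity
  linarith

/-- One factor `s` tames the logarithm, as `|s log s| < 1` on `(0,1]`; hence `k ≥ 1`. -/
theorem intervalIntegrable_abelKernel_mul_pow_mul_log (ha₀ : 0 < a) (ha₁ : a < 1) {k : ℕ}
    (hk : 1 ≤ k) :
    IntervalIntegrable (fun s => abelKernel a s * (s ^ k * log s)) volume 0 1 := by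
  refine (intervalIntegrable_abelKernel ha₀ ha₁).mul_of_bounded (M := 1)
    ((continuousOn_pow k).mul (continuousOn_log.mono fun s hs => hs.1.ne')) fun s hs => ?_
  obtain ⟨j, rfl⟩ := Nat.exists_eq_add_of_le hk
  have := abs_log_mul_self_lt s hs.1 hs.2
  rw [show s ^ (1 + j) * log s = s ^ j * (log s * s) by ring, abs_mul,
    abs_of_nonneg (pow_nonneg hs.1.le j)]
  exact mul_le_one₀ (pow_le_one₀ hs.1.le hs.2) (abs_nonneg _) this.le

end

/-! ### Weighted means along rays. -/

/-- The mean `∫₀¹ k(s) h(sz) ds` of a function along the segment from `0` to `z`. -/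
noncomputable def weightedMean (k : ℝ → ℝ) (h : ℂ → ℂ) (z : ℂ) : ℂ :=
  ∫ s in (0 : ℝ)..1, (k s : ℂ) * h ((s : ℂ) * z)

/-- `Ω` is star-shaped about `0`, lies in the closed disc of radius `R`, and contains the open set
`D`, which is star-shaped up to the centre. -/
structure IsStarPair (R : ℝ) (Ω D : Set ℂ) : Prop where
  isOpen : IsOpen D
  subset : D ⊆ Ω
  subset_closedBall : Ω ⊆ Metric.closedBall 0 R
  mul_mem : ∀ z ∈ Ω, ∀ s ∈ Icc (0 : ℝ) 1, (s : ℂ) * z ∈ Ω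
  mul_mem_open : ∀ z ∈ D, ∀ s ∈ Ioc (0 : ℝ) 1, (s : ℂ) * z ∈ D

/-- Functions continuous on `Ω`, analytic on `D` and real on `(0,R]`. -/
structure IsAdmissible (R : ℝ) (Ω D : Set ℂ) (w : ℂ → ℂ) : Prop where
  continuousOn : ContinuousOn w Ω
  differentiableOn : DifferentiableOn ℂ w D
  im_eq_zero : ∀ x : ℝ, 0 < x → x ≤ R → (w x).im = 0

theorem isStarPair_ball (R : ℝ) : IsStarPair R (Metric.closedBall 0 R) (Metric.ball 0 R) where
  isOpen := Metric.isOpen_ball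
  subset := Metric.ball_subset_closedBall
  subset_closedBall := subset_rfl
  mul_mem z hz s hs := by
    rw [mem_closedBall_zero_iff] at hz ⊢
    rw [norm_mul, Complex.norm_real, norm_of_nonneg hs.1]
    exact (mul_le_of_le_one_left (norm_nonneg _) hs.2).trans hz
  mul_mem_open z hz s hs := by
    rw [mem_ball_zero_iff] at hz ⊢
    rw [norm_mul, Complex.norm_real, norm_of_nonneg hs.1.le]
    exact (mul_le_of_le_one_left (norm_nonneg _) hs.2).trans_lt hz

theorem ofReal_mul_mem_slitPlane {s : ℝ} (hs : 0 < s) {z : ℂ} (hz : z ∈ Complex.slitPlane) :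
    (s : ℂ) * z ∈ Complex.slitPlane := by
  rw [Complex.mem_slitPlane_iff] at hz ⊢
  simp only [Complex.re_ofReal_mul, Complex.im_ofReal_mul]
  exact hz.imp (mul_pos hs) (mul_ne_zero hs.ne')

theorem isStarPair_cutDisc {R : ℝ} (hR : 0 < R) :
    IsStarPair R (insert 0 (closedCutDisc R)) (cutDisc R) where
  isOpen := Metric.isOpen_ball.inter Complex.isOpen_slitPlane
  subset z hz := Or.inr ⟨Metric.ball_subset_closedBall hz.1, hz.2⟩
  subset_closedBall := insert_subset (by simpa using hR.le) inter_subset_left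
  mul_mem z hz s hs := by
    rcases hz with rfl | hz
    · simp
    rcases hs.1.eq_or_lt with rfl | h0
    · simp
    · exact Or.inr ⟨(isStarPair_ball R).mul_mem z hz.1 s hs, ofReal_mul_mem_slitPlane h0 hz.2⟩
  mul_mem_open z hz s hs :=
    ⟨(isStarPair_ball R).mul_mem_open z hz.1 s hs, ofReal_mul_mem_slitPlane hs.1 hz.2⟩

section

variable {R : ℝ} {Ω D : Set ℂ} {k : ℝ → ℝ} {h h₁ h₂ : ℂ → ℂ}

theorem IsStarPair.continuousOn_comp_ray (hD : IsStarPair R Ω D) (hh : ContinuousOn h Ω) {z : ℂ}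
    (hz : z ∈ Ω) : ContinuousOn (fun s : ℝ => h ((s : ℂ) * z)) (Icc 0 1) :=
  hh.comp (by fun_prop) fun s hs => hD.mul_mem z hz s hs

theorem IsStarPair.intervalIntegrable (hD : IsStarPair R Ω D)
    (hk : IntervalIntegrable k volume 0 1) (hh : ContinuousOn h Ω) {z : ℂ} (hz : z ∈ Ω) :
    IntervalIntegrable (fun s : ℝ => (k s : ℂ) * h ((s : ℂ) * z)) volume 0 1 := by
  have hk' : IntervalIntegrable (fun s => (k s : ℂ)) volume 0 1 := by
    rw [intervalIntegrable_iff] at hk ⊢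
    exact hk.ofReal
  refine hk'.mul_continuousOn ?_
  rw [uIcc_of_le zero_le_one]
  exact hD.continuousOn_comp_ray hh hz

theorem weightedMean_congr {z : ℂ} (h : ∀ s ∈ Ioc (0 : ℝ) 1, h₁ (s * z) = h₂ (s * z)) :
    weightedMean k h₁ z = weightedMean k h₂ z := by
  unfold weightedMean
  rw [intervalIntegral.integral_of_le zero_le_one, intervalIntegral.integral_of_le zero_le_one]
  refine setIntegral_congr_fun measurableSet_Ioc fun s hs => ?_
  simp only [h s hs]

theorem norm_weightedMean_le
    (hk₀ : ∀ s ∈ Icc (0 : ℝ) 1, 0 ≤ k s) {z : ℂ} {B : ℝ → ℝ}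
    (hB : IntervalIntegrable (fun s => k s * B s) volume 0 1)
    (h_le : ∀ s ∈ Ioc (0 : ℝ) 1, ‖h (s * z)‖ ≤ B s) :
    ‖weightedMean k h z‖ ≤ ∫ s in (0 : ℝ)..1, k s * B s := by
  refine intervalIntegral.norm_integral_le_of_norm_le zero_le_one
    (Eventually.of_forall fun s hs => ?_) hB
  have h0 := hk₀ s (Ioc_subset_Icc_self hs)
  rw [norm_mul, Complex.norm_real, norm_of_nonneg h0]
  exact mul_le_mul_of_nonneg_left (h_le s hs) h0

theorem IsStarPair.weightedMean_sub (hD : IsStarPair R Ω D)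
    (hk : IntervalIntegrable k volume 0 1) (hh₁ : ContinuousOn h₁ Ω) (hh₂ : ContinuousOn h₂ Ω)
    {z : ℂ} (hz : z ∈ Ω) :
    weightedMean k h₁ z - weightedMean k h₂ z = weightedMean k (fun z => h₁ z - h₂ z) z := by
  unfold weightedMean
  rw [← intervalIntegral.integral_sub (hD.intervalIntegrable hk hh₁ hz)
    (hD.intervalIntegrable hk hh₂ hz)]
  simp only [mul_sub]

theorem IsStarPair.weightedMean_add (hD : IsStarPair R Ω D)
    (hk : IntervalIntegrable k volume 0 1) (hh₁ : ContinuousOn h₁ Ω) (hh₂ : ContinuousOn h₂ Ω)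
    {z : ℂ} (hz : z ∈ Ω) :
    weightedMean k (fun z => h₁ z + h₂ z) z = weightedMean k h₁ z + weightedMean k h₂ z := by
  unfold weightedMean
  rw [← intervalIntegral.integral_add (hD.intervalIntegrable hk hh₁ hz)
    (hD.intervalIntegrable hk hh₂ hz)]
  simp only [mul_add]

theorem weightedMean_const_mul (c z : ℂ) :
    weightedMean k (fun z => c * h z) z = c * weightedMean k h z := by
  unfold weightedMean
  rw [← intervalIntegral.integral_const_mul]
  simp only [mul_left_comm]

theorem weightedMean_const (c z : ℂ) :
    weightedMean k (fun _ => c) z = ((∫ s in (0 : ℝ)..1, k s : ℝ) : ℂ) * c := by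
  unfold weightedMean
  rw [intervalIntegral.integral_mul_const, intervalIntegral.integral_ofReal]

theorem IsStarPair.continuousOn_weightedMean (hD : IsStarPair R Ω D)
    (hk : IntervalIntegrable k volume 0 1) (hh : ContinuousOn h Ω) {M : ℝ}
    (hM : ∀ z ∈ Ω, ‖h z‖ ≤ M) : ContinuousOn (weightedMean k h) Ω := by
  intro z hz
  refine intervalIntegral.continuousWithinAt_of_dominated_interval (bound := fun s => ‖k s‖ * M)
    ?_ ?_ (hk.norm.mul_const M) ?_
  · filter_upwards [self_mem_nhdsWithin] with x hx
    have := hD.intervalIntegrable hk hh hx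
    rw [intervalIntegrable_iff] at this
    exact this.aestronglyMeasurable
  · filter_upwards [self_mem_nhdsWithin] with x hx
    refine Eventually.of_forall fun s hs => ?_
    rw [uIoc_of_le zero_le_one] at hs
    rw [norm_mul, Complex.norm_real]
    exact mul_le_mul_of_nonneg_left (hM _ (hD.mul_mem x hx s (Ioc_subset_Icc_self hs)))
      (norm_nonneg _)
  · refine Eventually.of_forall fun s hs => ?_
    rw [uIoc_of_le zero_le_one] at hs
    refine continuousWithinAt_const.mul ?_
    exact (hh.comp (t := Ω) (f := fun z : ℂ => (s : ℂ) * z) (by fun_prop)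
      fun x hx => hD.mul_mem x hx s (Ioc_subset_Icc_self hs)) z hz

/-- Differentiation under the integral sign. Cauchy's estimate for `y ↦ h(sy)` on a circle around a
point near `z` bounds the derivative uniformly in `s`, so nothing need be known about `h'` near the
centre. -/
theorem IsStarPair.differentiableOn_weightedMean (hD : IsStarPair R Ω D)
    (hk : IntervalIntegrable k volume 0 1) (hh : ContinuousOn h Ω) (hd : DifferentiableOn ℂ h D)
    {M : ℝ} (hM : ∀ z ∈ Ω, ‖h z‖ ≤ M) : DifferentiableOn ℂ (weightedMean k h) D := by
  intro z hz
  obtain ⟨ε, hε, hball⟩ := Metric.isOpen_iff.1 hD.isOpen z hz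
  have hδ : 0 < ε / 2 := by positivity
  have hdiff : ∀ s ∈ Ioc (0 : ℝ) 1, DifferentiableOn ℂ (fun y : ℂ => h (s * y)) D := fun s hs =>
    hd.comp (by fun_prop) fun x hx => hD.mul_mem_open x hx s hs
  have hsub : ∀ x ∈ Metric.ball z (ε / 2), Metric.closedBall x (ε / 2) ⊆ D := fun x hx y hy => by
    refine hball ?_
    rw [Metric.mem_ball] at hx ⊢
    rw [Metric.mem_closedBall] at hy
    linarith [dist_triangle y x z]
  have hx_mem : ∀ x ∈ Metric.ball z (ε / 2), x ∈ D := fun x hx =>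
    hsub x hx (Metric.mem_closedBall_self hδ.le)
  have key := intervalIntegral.hasDerivAt_integral_of_dominated_loc_of_deriv_le
    (F := fun x (s : ℝ) => (k s : ℂ) * h (s * x))
    (F' := fun x (s : ℝ) => (k s : ℂ) * deriv (fun y : ℂ => h (s * y)) x)
    (μ := volume) (a := 0) (b := 1) (x₀ := z) (bound := fun s => ‖k s‖ * (M / (ε / 2)))
    (Metric.ball_mem_nhds z hδ) ?_ (hD.intervalIntegrable hk hh (hD.subset hz)) ?_ ?_
    (hk.norm.mul_const _) ?_
  · exact key.2.differentiableAt.differentiableWithinAt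
  · filter_upwards [Metric.ball_mem_nhds z hδ] with x hx
    have := hD.intervalIntegrable hk hh (hD.subset (hx_mem x hx))
    rw [intervalIntegrable_iff] at this
    exact this.aestronglyMeasurable
  · rw [uIoc_of_le zero_le_one]
    refine AEStronglyMeasurable.mul ?_ ?_
    · rw [intervalIntegrable_iff, uIoc_of_le zero_le_one] at hk
      exact Integrable.aestronglyMeasurable hk.ofReal
    · have : ContinuousOn (fun s : ℝ => (s : ℂ) * deriv h (s * z)) (Ioc 0 1) := by
        refine ContinuousOn.mul (by fun_prop) ?_
        exact (hd.deriv hD.isOpen).continuousOn.comp (by fun_prop)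
          fun s hs => hD.mul_mem_open z hz s hs
      refine (this.aestronglyMeasurable measurableSet_Ioc).congr ?_
      filter_upwards with s
      rw [deriv_comp_mul_left]
      rfl
  · refine Eventually.of_forall fun s hs x hx => ?_
    rw [uIoc_of_le zero_le_one] at hs
    rw [norm_mul, Complex.norm_real]
    refine mul_le_mul_of_nonneg_left ?_ (norm_nonneg _)
    refine Complex.norm_deriv_le_of_forall_mem_sphere_norm_le hδ ?_ fun y hy => ?_
    · refine DifferentiableOn.diffContOnCl ((hdiff s hs).mono ?_)
      exact Metric.closure_ball_subset_closedBall.trans (hsub x hx)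
    · exact hM _ (hD.subset (hD.mul_mem_open _ (hsub x hx (Metric.sphere_subset_closedBall hy))
        s hs))
  · refine Eventually.of_forall fun s hs x hx => ?_
    rw [uIoc_of_le zero_le_one] at hs
    exact (((hdiff s hs).differentiableAt
      (hD.isOpen.mem_nhds (hx_mem x hx))).hasDerivAt).const_mul _

theorem weightedMean_im_eq_zero (hh : ∀ x : ℝ, 0 < x → x ≤ R → (h x).im = 0) {x : ℝ}
    (hx₀ : 0 < x) (hx : x ≤ R) : (weightedMean k h x).im = 0 := by
  have : weightedMean k h x = ((∫ s in (0 : ℝ)..1, k s * (h (s * x)).re : ℝ) : ℂ) := by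
    rw [← intervalIntegral.integral_ofReal, weightedMean,
      intervalIntegral.integral_of_le zero_le_one, intervalIntegral.integral_of_le zero_le_one]
    refine setIntegral_congr_fun measurableSet_Ioc fun s hs => ?_
    have him : (h (s * x)).im = 0 := by
      have := hh (s * x) (mul_pos hs.1 hx₀) ((mul_le_of_le_one_left hx₀.le hs.2).trans hx)
      simpa using this
    apply Complex.ext <;> simp [him]
  rw [this, Complex.ofReal_im]

theorem IsAdmissible.weightedMean (hD : IsStarPair R Ω D) (hk : IntervalIntegrable k volume 0 1)
    (hh : IsAdmissible R Ω D h) {M : ℝ} (hM : ∀ z ∈ Ω, ‖h z‖ ≤ M) :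
    IsAdmissible R Ω D (weightedMean k h) where
  continuousOn := hD.continuousOn_weightedMean hk hh.continuousOn hM
  differentiableOn := hD.differentiableOn_weightedMean hk hh.continuousOn hh.differentiableOn hM
  im_eq_zero _ := weightedMean_im_eq_zero hh.im_eq_zero

end

/-! ### Abel's inversion, from monomials to continuous functions. -/

theorem weightedMean_const_mul_pow (k : ℝ → ℝ) (c : ℂ) (n : ℕ) (z : ℂ) :
    weightedMean k (fun w => c * w ^ n) z
      = ((∫ s in (0 : ℝ)..1, k s * s ^ n : ℝ) : ℂ) * (c * z ^ n) := by
  rw [weightedMean, ← intervalIntegral.integral_ofReal, ← intervalIntegral.integral_mul_const]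
  congr 1
  ext s
  push_cast
  ring

/-- With an empty open part, the general statements on means apply to functions that are merely
continuous on one segment. -/
theorem isStarPair_segment (z : ℂ) :
    IsStarPair ‖z‖ ((fun s : ℝ => (s : ℂ) * z) '' Icc (0 : ℝ) 1) ∅ where
  isOpen := isOpen_empty
  subset := empty_subset _
  subset_closedBall := by
    rintro _ ⟨s, hs, rfl⟩
    exact (isStarPair_ball ‖z‖).mul_mem z (by simp) s hs
  mul_mem := by
    rintro _ ⟨t, ht, rfl⟩ s hs
    exact ⟨s * t, ⟨mul_nonneg hs.1 ht.1, mul_le_one₀ hs.2 ht.1 ht.2⟩, by push_cast; ring⟩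
  mul_mem_open _ h := h.elim

/-- Weierstrass' theorem for the real and the imaginary part. -/
theorem exists_complex_polynomial_near {φ : ℝ → ℂ} (hφ : ContinuousOn φ (Icc 0 1)) {ε : ℝ}
    (hε : 0 < ε) : ∃ p : Polynomial ℂ, ∀ s ∈ Icc (0 : ℝ) 1, ‖φ s - p.eval (s : ℂ)‖ ≤ ε := by
  obtain ⟨p, hp⟩ := exists_polynomial_near_of_continuousOn 0 1 (fun s => (φ s).re)
    (Complex.continuous_re.comp_continuousOn hφ) (ε / 2) (by positivity)
  obtain ⟨q, hq⟩ := exists_polynomial_near_of_continuousOn 0 1 (fun s => (φ s).im)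
    (Complex.continuous_im.comp_continuousOn hφ) (ε / 2) (by positivity)
  refine ⟨p.map Complex.ofRealHom + Polynomial.C Complex.I * q.map Complex.ofRealHom,
    fun s hs => ?_⟩
  have h1 := hp s hs
  have h2 := hq s hs
  refine (Complex.norm_le_abs_re_add_abs_im _).trans ?_
  have e : ∀ r : Polynomial ℝ,
      (r.map Complex.ofRealHom).eval (s : ℂ) = ((r.eval s : ℝ) : ℂ) := fun r => by
    have := Polynomial.eval_map_apply (p := r) Complex.ofRealHom s
    simpa using this
  rw [abs_sub_comm] at h1 h2
  simp only [Polynomial.eval_add, Polynomial.eval_mul, Polynomial.eval_C, e]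
  simp
  linarith

section

variable {a : ℝ}

theorem intervalIntegrable_rpow_neg (ha₁ : a < 1) :
    IntervalIntegrable (fun s : ℝ => s ^ (-a)) volume 0 1 :=
  intervalIntegral.intervalIntegrable_rpow' (by linarith)

theorem intervalIntegrable_one_sub_rpow_neg (ha₁ : a < 1) :
    IntervalIntegrable (fun s : ℝ => (1 - s) ^ (-a)) volume 0 1 := by
  have h := intervalIntegrable_rpow_mul_one_sub_rpow (u := 1) (v := 1 - a) one_pos (by linarith)
  simpa [sub_sub_cancel_left] using h

theorem integral_one_sub_rpow_neg_mul_pow (ha₁ : a < 1) (n : ℕ) :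
    ∫ s in (0 : ℝ)..1, (1 - s) ^ (-a) * s ^ n
      = Gamma (n + 1) * Gamma (1 - a) / Gamma (n + 2 - a) := by
  have h := integral_rpow_mul_one_sub_rpow (u := n + 1) (v := 1 - a) (by positivity) (by linarith)
  rw [show (n : ℝ) + 1 + (1 - a) = n + 2 - a by ring] at h
  rw [← h]
  congr 1
  ext s
  rw [add_sub_cancel_right, rpow_natCast, sub_sub_cancel_left, mul_comm]

theorem integral_rpow_neg_mul_pow (ha₁ : a < 1) (n : ℕ) :
    ∫ s in (0 : ℝ)..1, s ^ (-a) * s ^ n = 1 / (n + 1 - a) := by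
  have : ∫ s in (0 : ℝ)..1, s ^ (-a) * s ^ n = ∫ s in (0 : ℝ)..1, s ^ (n - a) := by
    rw [intervalIntegral.integral_of_le zero_le_one, intervalIntegral.integral_of_le zero_le_one]
    refine setIntegral_congr_fun measurableSet_Ioc fun s hs => ?_
    rw [← rpow_natCast, ← rpow_add hs.1]
    ring_nf
  have hn : (0 : ℝ) ≤ n := n.cast_nonneg
  rw [this, integral_rpow (Or.inl (by linarith)), one_rpow, zero_rpow (by linarith)]
  ring

/-- All three means act on `z^n` by scalars. The identity of these scalars reduces to `Γ(n+2-a) =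
(n+1-a) Γ(n+1-a)`. -/
theorem weightedMean_abelKernel_monomial (ha₀ : 0 < a) (ha₁ : a < 1) (c : ℂ) (n : ℕ) (z : ℂ) :
    weightedMean (fun s => (1 - s) ^ (-a)) (weightedMean (abelKernel a) fun w => c * w ^ n) z
      = Gamma (1 - a) * weightedMean (fun s => s ^ (-a)) (fun w => c * w ^ n) z := by
  have h1 : weightedMean (abelKernel a) (fun w => c * w ^ n)
      = fun w => (abelMoment a n * c) * w ^ n := by
    ext w
    rw [weightedMean_const_mul_pow]
    simp only [abelMoment, rpow_natCast]
    ring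
  have hn : (0 : ℝ) ≤ n := n.cast_nonneg
  rw [h1, weightedMean_const_mul_pow, weightedMean_const_mul_pow, integral_rpow_neg_mul_pow ha₁,
    integral_one_sub_rpow_neg_mul_pow ha₁, abelMoment_eq ha₀ ha₁ hn]
  have hpos : (n : ℝ) + 1 - a ≠ 0 := by linarith
  have hG := (Gamma_pos_of_pos (show 0 < (n : ℝ) + 1 - a by linarith)).ne'
  have hG' := (Gamma_pos_of_pos (show 0 < (n : ℝ) + 1 by linarith)).ne'
  have e : Gamma (n + 2 - a) = (n + 1 - a) * Gamma (n + 1 - a) := by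
    rw [← Gamma_add_one hpos]; ring_nf
  have : Gamma (n + 1) * Gamma (1 - a) / Gamma (n + 2 - a) * (Gamma (n + 1 - a) / Gamma (n + 1))
      = Gamma (1 - a) * (1 / (n + 1 - a)) := by
    rw [e]; field_simp
  have := congrArg (Complex.ofReal) this
  push_cast at this ⊢
  linear_combination (c * z ^ n) * this

/-- Abel's inversion of the weighted means for polynomials. -/
theorem weightedMean_abelKernel_polynomial (ha₀ : 0 < a) (ha₁ : a < 1) (p : Polynomial ℂ) (z : ℂ) :
    weightedMean (fun s => (1 - s) ^ (-a)) (weightedMean (abelKernel a) fun w => p.eval w) z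
      = Gamma (1 - a) * weightedMean (fun s => s ^ (-a)) (fun w => p.eval w) z := by
  have hD := isStarPair_ball ‖z‖
  have hz : z ∈ Metric.closedBall 0 ‖z‖ := by simp
  have hK := intervalIntegrable_abelKernel ha₀ ha₁
  have hc : ∀ p : Polynomial ℂ, ContinuousOn
      (weightedMean (abelKernel a) fun w => p.eval w) (Metric.closedBall 0 ‖z‖) := fun p => by
    obtain ⟨M, hM⟩ := (isCompact_closedBall (0 : ℂ) ‖z‖).exists_bound_of_continuousOn
      p.continuous.continuousOn
    exact hD.continuousOn_weightedMean hK p.continuous.continuousOn hM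
  induction p using Polynomial.induction_on' with
  | add p q hp hq =>
    simp only [Polynomial.eval_add]
    rw [hD.weightedMean_add (intervalIntegrable_rpow_neg ha₁) p.continuous.continuousOn
      q.continuous.continuousOn hz, mul_add, ← hp, ← hq,
      ← hD.weightedMean_add (intervalIntegrable_one_sub_rpow_neg ha₁) (hc p) (hc q) hz]
    refine weightedMean_congr fun s hs => ?_
    exact hD.weightedMean_add hK p.continuous.continuousOn q.continuous.continuousOn
      (hD.mul_mem z hz s (Ioc_subset_Icc_self hs))
  | monomial n c =>
    simp only [Polynomial.eval_monomial]
    exact weightedMean_abelKernel_monomial ha₀ ha₁ c n z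

theorem norm_weightedMean_le_of_le {k : ℝ → ℝ} {h : ℂ → ℂ}
    (hk : IntervalIntegrable k volume 0 1) (hk₀ : ∀ s ∈ Icc (0 : ℝ) 1, 0 ≤ k s) {z : ℂ} {ε : ℝ}
    (h_le : ∀ s ∈ Ioc (0 : ℝ) 1, ‖h (s * z)‖ ≤ ε) :
    ‖weightedMean k h z‖ ≤ (∫ s in (0 : ℝ)..1, k s) * ε := by
  rw [← intervalIntegral.integral_mul_const]
  exact norm_weightedMean_le hk₀ (hk.mul_const ε) h_le

/-- Abel's inversion of the weighted means at the point `1`. -/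
theorem weightedMean_abelKernel_one (ha₀ : 0 < a) (ha₁ : a < 1) {h : ℂ → ℂ}
    (hh : ContinuousOn (fun s : ℝ => h s) (Icc (0 : ℝ) 1)) :
    weightedMean (fun s => (1 - s) ^ (-a)) (weightedMean (abelKernel a) h) 1
      = Gamma (1 - a) * weightedMean (fun s => s ^ (-a)) h 1 := by
  set Ω : Set ℂ := (fun s : ℝ => (s : ℂ) * 1) '' Icc (0 : ℝ) 1 with hΩ
  have hD : IsStarPair ‖(1 : ℂ)‖ Ω ∅ := isStarPair_segment 1
  have h1 : (1 : ℂ) ∈ Ω := ⟨1, by simp, by simp⟩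
  have hK := intervalIntegrable_abelKernel ha₀ ha₁
  have hk₂ := intervalIntegrable_one_sub_rpow_neg ha₁
  have hk₃ := intervalIntegrable_rpow_neg ha₁
  have hK₀ : ∀ s ∈ Icc (0 : ℝ) 1, 0 ≤ abelKernel a s := fun s hs => abelKernel_nonneg ha₀ hs
  have hk₂₀ : ∀ s ∈ Icc (0 : ℝ) 1, 0 ≤ (1 - s) ^ (-a) := fun s hs =>
    rpow_nonneg (by linarith [hs.2]) _
  have hk₃₀ : ∀ s ∈ Icc (0 : ℝ) 1, 0 ≤ s ^ (-a) := fun s hs => rpow_nonneg hs.1 _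
  have hcΩ : IsCompact Ω := isCompact_Icc.image (by fun_prop)
  have hre : ∀ w ∈ Ω, w.re ∈ Icc (0 : ℝ) 1 ∧ (w.re : ℂ) = w := by
    rintro _ ⟨s, hs, rfl⟩; simpa using hs
  have hhΩ : ContinuousOn h Ω := by
    refine (hh.comp Complex.continuous_re.continuousOn fun w hw => (hre w hw).1).congr
      fun w hw => ?_
    simp [(hre w hw).2]
  have hcont : ∀ f : ℂ → ℂ, ContinuousOn f Ω → ContinuousOn (weightedMean (abelKernel a) f) Ω :=
    fun f hf => by
      obtain ⟨M, hM⟩ := hcΩ.exists_bound_of_continuousOn hf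
      exact hD.continuousOn_weightedMean hK hf hM
  set C := (∫ s in (0 : ℝ)..1, (1 - s) ^ (-a)) * (∫ s in (0 : ℝ)..1, abelKernel a s)
    + |Gamma (1 - a)| * ∫ s in (0 : ℝ)..1, s ^ (-a) with hC
  -- Both sides are bounded linear in `h` for the sup norm on the segment and agree on polynomials;
  -- an `ε`-approximation of `h` leaves a defect of at most `C ε`.
  have bound : ∀ ε > 0, ‖weightedMean (fun s => (1 - s) ^ (-a)) (weightedMean (abelKernel a) h) 1
      - Gamma (1 - a) * weightedMean (fun s => s ^ (-a)) h 1‖ ≤ C * ε := by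
    intro ε hε
    obtain ⟨p, hp⟩ := exists_complex_polynomial_near hh hε
    set f : ℂ → ℂ := fun w => h w - p.eval w with hf
    have hpc : ContinuousOn (fun w : ℂ => p.eval w) Ω := p.continuous.continuousOn
    have hfε : ∀ w ∈ Ω, ‖f w‖ ≤ ε := fun w hw => by
      have := hp w.re (hre w hw).1
      rwa [(hre w hw).2] at this
    have e1 : weightedMean (fun s => (1 - s) ^ (-a)) (weightedMean (abelKernel a) f) 1
        = weightedMean (fun s => (1 - s) ^ (-a)) (weightedMean (abelKernel a) h) 1
        - weightedMean (fun s => (1 - s) ^ (-a))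
          (weightedMean (abelKernel a) fun w => p.eval w) 1 := by
      rw [hD.weightedMean_sub hk₂ (hcont _ hhΩ) (hcont _ hpc) h1]
      refine weightedMean_congr fun s hs => ?_
      rw [hD.weightedMean_sub hK hhΩ hpc (hD.mul_mem 1 h1 s (Ioc_subset_Icc_self hs))]
    have e2 := hD.weightedMean_sub hk₃ hhΩ hpc h1
    have e3 := weightedMean_abelKernel_polynomial ha₀ ha₁ p 1
    have e4 : weightedMean (fun s => (1 - s) ^ (-a)) (weightedMean (abelKernel a) h) 1
        - Gamma (1 - a) * weightedMean (fun s => s ^ (-a)) h 1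
        = weightedMean (fun s => (1 - s) ^ (-a)) (weightedMean (abelKernel a) f) 1
        - Gamma (1 - a) * weightedMean (fun s => s ^ (-a)) f 1 := by
      rw [e1, hf, ← e2, e3]; ring
    have b1 : ‖weightedMean (fun s => (1 - s) ^ (-a)) (weightedMean (abelKernel a) f) 1‖
        ≤ (∫ s in (0 : ℝ)..1, (1 - s) ^ (-a)) * ((∫ s in (0 : ℝ)..1, abelKernel a s) * ε) := by
      refine norm_weightedMean_le_of_le hk₂ hk₂₀ fun s hs => ?_
      refine norm_weightedMean_le_of_le hK hK₀ fun t ht => hfε _ ?_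
      exact hD.mul_mem _ (hD.mul_mem 1 h1 s (Ioc_subset_Icc_self hs)) t (Ioc_subset_Icc_self ht)
    have b2 : ‖weightedMean (fun s => s ^ (-a)) f 1‖ ≤ (∫ s in (0 : ℝ)..1, s ^ (-a)) * ε :=
      norm_weightedMean_le_of_le hk₃ hk₃₀ fun s hs =>
        hfε _ (hD.mul_mem 1 h1 s (Ioc_subset_Icc_self hs))
    rw [e4]
    refine (norm_sub_le _ _).trans ?_
    rw [norm_mul, Complex.norm_real, Real.norm_eq_abs]
    have := mul_le_mul_of_nonneg_left b2 (abs_nonneg (Gamma (1 - a)))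
    rw [hC]
    linarith
  rw [← sub_eq_zero, ← norm_le_zero_iff]
  have ht : Tendsto (fun ε : ℝ => C * ε) (𝓝[>] 0) (𝓝 0) := by
    have : Tendsto (fun ε : ℝ => C * ε) (𝓝 0) (𝓝 (C * 0)) := tendsto_id.const_mul C
    rw [mul_zero] at this
    exact this.mono_left nhdsWithin_le_nhds
  refine ge_of_tendsto ht ?_
  filter_upwards [self_mem_nhdsWithin] with ε hε using bound ε hε

/-- Abel's inversion of the weighted means. -/
theorem weightedMean_abelKernel (ha₀ : 0 < a) (ha₁ : a < 1) {h : ℂ → ℂ} {z : ℂ}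
    (hh : ContinuousOn (fun s : ℝ => h (s * z)) (Icc (0 : ℝ) 1)) :
    weightedMean (fun s => (1 - s) ^ (-a)) (weightedMean (abelKernel a) h) z
      = Gamma (1 - a) * weightedMean (fun s => s ^ (-a)) h z := by
  -- A mean of `h` at `z` is the mean of `w ↦ h(wz)` at `1`.
  have := weightedMean_abelKernel_one ha₀ ha₁ (h := fun w => h (w * z)) hh
  simpa [weightedMean, mul_assoc, mul_left_comm] using this

end

/-! ### Fractional integrals and derivatives of weighted means. -/

theorem Complex.ofReal_mul_cpow {r : ℝ} (hr : 0 ≤ r) (z : ℂ) {c : ℂ} (hc : c ≠ 0) :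
    ((r : ℂ) * z) ^ c = (r : ℂ) ^ c * z ^ c := by
  rcases hr.eq_or_lt with rfl | hr
  · simp [hc]
  by_cases hz : z = 0
  · simp [hz, hc]
  have hr' : (r : ℂ) ≠ 0 := by exact_mod_cast hr.ne'
  rw [Complex.cpow_def_of_ne_zero (mul_ne_zero hr' hz), Complex.cpow_def_of_ne_zero hr',
    Complex.cpow_def_of_ne_zero hz, Complex.log_ofReal_mul hr hz, ← Complex.exp_add,
    Complex.ofReal_log hr.le]
  ring_nf

section

variable {a : ℝ}

/-- The substitution `s ↦ st` turns the expression into `∫₀ᵗ s^(-a) ψ(s) ds`, to which the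
fundamental theorem of calculus applies at `t > 0`. -/
theorem hasDerivWithinAt_rpow_smul_integral {E : Type*} [NormedAddCommGroup E] [NormedSpace ℝ E]
    [CompleteSpace E] (ha₁ : a < 1) {ψ : ℝ → E} {T t : ℝ} (hψ : ContinuousOn ψ (Icc 0 T))
    (ht : t ∈ Ioc 0 T) :
    HasDerivWithinAt (fun t => t ^ (1 - a) • ∫ s in (0 : ℝ)..1, s ^ (-a) • ψ (s * t))
      (t ^ (-a) • ψ t) (Icc 0 T) t := by
  have hT : 0 < T := ht.1.trans_le ht.2
  have hcont : ContinuousOn (fun s => s ^ (-a) • ψ s) (Ioc 0 T) :=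
    (continuousOn_id.rpow_const fun s hs => Or.inl hs.1.ne').smul
      (hψ.mono Ioc_subset_Icc_self)
  have hint : IntervalIntegrable (fun s => s ^ (-a) • ψ s) volume 0 t := by
    refine IntervalIntegrable.smul_continuousOn
      (intervalIntegral.intervalIntegrable_rpow' (by linarith)) ?_
    rw [uIcc_of_le ht.1.le]
    exact hψ.mono (Icc_subset_Icc_right ht.2)
  have : Fact (t ∈ Icc 0 T) := ⟨Ioc_subset_Icc_self ht⟩
  have hnhds : Ioc 0 T ∈ 𝓝[Icc 0 T] t := by
    have : Ioi (0 : ℝ) ∈ 𝓝[Icc 0 T] t := mem_nhdsWithin_of_mem_nhds (Ioi_mem_nhds ht.1)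
    filter_upwards [this, self_mem_nhdsWithin] with s h1 h2 using ⟨h1, h2.2⟩
  have key : HasDerivWithinAt (fun t => ∫ s in (0 : ℝ)..t, s ^ (-a) • ψ s)
      (t ^ (-a) • ψ t) (Icc 0 T) t := by
    refine intervalIntegral.integral_hasDerivWithinAt_right hint ?_ ?_
    · exact ⟨_, hnhds, hcont.aestronglyMeasurable measurableSet_Ioc⟩
    · exact (hcont t ht).mono_of_mem_nhdsWithin hnhds
  have e : ∀ x ∈ Ioc 0 T, x ^ (1 - a) • ∫ s in (0 : ℝ)..1, s ^ (-a) • ψ (s * x)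
      = ∫ s in (0 : ℝ)..x, s ^ (-a) • ψ s := fun x hx => by
    have h1 := intervalIntegral.smul_integral_comp_mul_right (a := 0) (b := 1)
      (fun s => s ^ (-a) • ψ s) x
    rw [zero_mul, one_mul] at h1
    rw [← h1, show 1 - a = 1 + -a by ring, rpow_add hx.1, rpow_one, mul_smul,
      ← intervalIntegral.integral_smul]
    congr 1
    rw [intervalIntegral.integral_of_le zero_le_one, intervalIntegral.integral_of_le zero_le_one]
    refine setIntegral_congr_fun measurableSet_Ioc fun s hs => ?_
    rw [mul_rpow hs.1.le hx.1.le, smul_smul, mul_comm]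
  exact key.congr_of_eventuallyEq (by filter_upwards [hnhds] with x hx using e x hx) (e t ht)

theorem complexFracIntegral_eq (ha₀ : a ≠ 0) {u : ℂ → ℂ} {z : ℂ} (hz : z ≠ 0) :
    complexFracIntegral a u z = (1 / Gamma (1 - a) : ℝ) *
      (z ^ (1 - (a : ℂ)) * weightedMean (fun s => (1 - s) ^ (-a)) u z) := by
  unfold complexFracIntegral weightedMean
  congr 1
  rw [← intervalIntegral.integral_const_mul, intervalIntegral.integral_of_le zero_le_one,
    intervalIntegral.integral_of_le zero_le_one]
  refine setIntegral_congr_fun measurableSet_Ioc fun s hs => ?_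
  have hs' : 0 ≤ 1 - s := by linarith [hs.2]
  have ha : -(a : ℂ) ≠ 0 := by simpa using ha₀
  simp only
  rw [show z - s * z = ((1 - s : ℝ) : ℂ) * z by push_cast; ring, Complex.ofReal_mul_cpow hs' z ha,
    show 1 - (a : ℂ) = 1 + -a by ring, Complex.cpow_add _ _ hz, Complex.cpow_one,
    Complex.ofReal_cpow hs']
  push_cast
  ring

variable {R : ℝ} {u φ : ℂ → ℂ}

/-- The fractional integral of `u = weightedMean (abelKernel a) φ` in terms of `φ`. -/
theorem complexFracIntegral_weightedMean (ha₀ : 0 < a) (ha₁ : a < 1) {Ω D : Set ℂ}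
    (hD : IsStarPair R Ω D) (hφ : ContinuousOn φ Ω)
    (hu : ∀ z ∈ Ω, u z = weightedMean (abelKernel a) φ z) {z : ℂ} (hz : z ∈ Ω) (hz₀ : z ≠ 0) :
    complexFracIntegral a u z
      = z ^ (1 - (a : ℂ)) * weightedMean (fun s => s ^ (-a)) φ z := by
  have hG := (Gamma_pos_of_pos (show 0 < 1 - a by linarith)).ne'
  have hG' : (Gamma (1 - a) : ℂ) ≠ 0 := by exact_mod_cast hG
  have : weightedMean (fun s => (1 - s) ^ (-a)) u z
      = Gamma (1 - a) * weightedMean (fun s => s ^ (-a)) φ z := by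
    rw [← weightedMean_abelKernel ha₀ ha₁ (hD.continuousOn_comp_ray hφ hz)]
    exact weightedMean_congr fun s hs => hu _ (hD.mul_mem z hz s (Ioc_subset_Icc_self hs))
  rw [complexFracIntegral_eq ha₀.ne' hz₀, this]
  push_cast
  field_simp

/-- The radial derivative serves twice: with `z = 1` it gives the real equation up to the endpoint
`R`, and at `t = 1` it identifies the complex derivative. -/
theorem hasDerivWithinAt_complexFracIntegral_ray (ha₀ : 0 < a) (ha₁ : a < 1) {Ω D : Set ℂ}
    (hD : IsStarPair R Ω D) (hφ : ContinuousOn φ Ω)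
    (hu : ∀ z ∈ Ω, u z = weightedMean (abelKernel a) φ z) {z : ℂ} (hz₀ : z ≠ 0) {T t : ℝ}
    (hT : ∀ t ∈ Icc 0 T, (t : ℂ) * z ∈ Ω) (ht : t ∈ Ioc 0 T) :
    HasDerivWithinAt (fun t : ℝ => complexFracIntegral a u (t * z))
      (z ^ (1 - (a : ℂ)) * ((t ^ (-a) : ℝ) * φ (t * z))) (Icc 0 T) t := by
  have hc : ContinuousOn (fun t : ℝ => φ (t * z)) (Icc 0 T) :=
    hφ.comp (by fun_prop) fun t ht => hT t ht
  have h1 := hasDerivWithinAt_rpow_smul_integral ha₁ hc ht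
  have h2 := h1.const_mul (z ^ (1 - (a : ℂ)))
  have e : ∀ x ∈ Ioc 0 T, complexFracIntegral a u (x * z) = z ^ (1 - (a : ℂ)) *
      (x ^ (1 - a) • ∫ s in (0 : ℝ)..1, s ^ (-a) • φ ((s * x : ℝ) * z)) := fun x hx => by
    have hx0 : (x : ℂ) ≠ 0 := by exact_mod_cast hx.1.ne'
    have hne : 1 - (a : ℂ) ≠ 0 := by
      rw [sub_ne_zero]; exact_mod_cast ha₁.ne'
    rw [complexFracIntegral_weightedMean ha₀ ha₁ hD hφ hu (hT x (Ioc_subset_Icc_self hx))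
      (mul_ne_zero hx0 hz₀), Complex.ofReal_mul_cpow hx.1.le z hne]
    simp only [weightedMean, Complex.real_smul]
    rw [Complex.ofReal_cpow hx.1.le]
    push_cast
    simp only [mul_assoc]
    ring
  have hnhds : Ioc 0 T ∈ 𝓝[Icc 0 T] t := by
    have : Ioi (0 : ℝ) ∈ 𝓝[Icc 0 T] t := mem_nhdsWithin_of_mem_nhds (Ioi_mem_nhds ht.1)
    filter_upwards [this, self_mem_nhdsWithin] with s h1 h2 using ⟨h1, h2.2⟩
  refine (h2.congr_of_eventuallyEq ?_ (e t ht)).congr_deriv ?_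
  · filter_upwards [hnhds] with x hx using e x hx
  · rw [Complex.real_smul]

/-- Complex differentiability is clear from the product formula for the fractional integral. The
value of the derivative can therefore be read off along the ray through `z`, even from one side. -/
theorem hasDerivAt_complexFracIntegral (ha₀ : 0 < a) (ha₁ : a < 1) (hR : 0 < R)
    (hφ : ContinuousOn φ (insert 0 (closedCutDisc R))) (hφ' : DifferentiableOn ℂ φ (cutDisc R))
    {M : ℝ} (hM : ∀ z ∈ insert 0 (closedCutDisc R), ‖φ z‖ ≤ M)
    (hu : ∀ z ∈ insert 0 (closedCutDisc R), u z = weightedMean (abelKernel a) φ z) {z : ℂ}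
    (hz : z ∈ cutDisc R) :
    HasDerivAt (complexFracIntegral a u) (z ^ (-(a : ℂ)) * φ z) z := by
  have hD := isStarPair_cutDisc hR
  have hne : ∀ w ∈ cutDisc R, w ≠ 0 := fun w hw => Complex.slitPlane_ne_zero hw.2
  have hz0 := hne z hz
  have hev : ∀ᶠ w in 𝓝 z, complexFracIntegral a u w
      = w ^ (1 - (a : ℂ)) * weightedMean (fun s => s ^ (-a)) φ w := by
    filter_upwards [hD.isOpen.mem_nhds hz] with w hw
    exact complexFracIntegral_weightedMean ha₀ ha₁ hD hφ hu (hD.subset hw) (hne w hw)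
  have hdiff : DifferentiableAt ℂ (complexFracIntegral a u) z := by
    refine DifferentiableAt.congr_of_eventuallyEq ?_ hev
    refine DifferentiableAt.mul ?_ ?_
    · exact (differentiableAt_id).cpow_const hz.2
    · exact (hD.differentiableOn_weightedMean (intervalIntegrable_rpow_neg ha₁) hφ hφ'
        hM).differentiableAt (hD.isOpen.mem_nhds hz)
  have h1 := hasDerivWithinAt_complexFracIntegral_ray ha₀ ha₁ hD hφ hu hz0 (T := 1) (t := 1)
    (hD.mul_mem z (hD.subset hz)) (by simp)
  have h2 : HasDerivWithinAt (fun t : ℝ => complexFracIntegral a u (t * z))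
      (deriv (complexFracIntegral a u) z * z) (Icc 0 1) 1 := by
    have hz1 : ((1 : ℝ) : ℂ) * z = z := by simp
    have ho : HasDerivAt (fun t : ℝ => (t : ℂ) * z) z 1 := by
      simpa using (Complex.ofRealCLM.hasDerivAt (x := (1 : ℝ))).mul_const z
    have hd : HasDerivAt (complexFracIntegral a u) (deriv (complexFracIntegral a u) z)
        (((1 : ℝ) : ℂ) * z) := by rw [hz1]; exact hdiff.hasDerivAt
    exact (HasDerivAt.comp (1 : ℝ) hd ho).hasDerivWithinAt
  have h3 := (uniqueDiffOn_Icc (zero_lt_one' ℝ) 1 (by simp)).eq_deriv _ h1 h2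
  have h4 : deriv (complexFracIntegral a u) z = z ^ (-(a : ℂ)) * φ z := by
    apply mul_right_cancel₀ hz0
    rw [← h3, show 1 - (a : ℂ) = 1 + -a by ring, Complex.cpow_add _ _ hz0]
    simp
    ring
  rw [← h4]
  exact hdiff.hasDerivAt

/-- Substitute `s ↦ sx`; on `(0,R]` the function `u` coincides with its real part. -/
theorem ofReal_realFracIntegral (him : ∀ x : ℝ, 0 < x → x ≤ R → (u x).im = 0) {x : ℝ}
    (hx : x ∈ Ioc 0 R) :
    ((realFracIntegral a (fun x => (u x).re) x : ℝ) : ℂ) = complexFracIntegral a u x := by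
  unfold realFracIntegral complexFracIntegral
  rw [Complex.ofReal_mul]
  congr 1
  have h1 := intervalIntegral.smul_integral_comp_mul_right (a := 0) (b := 1)
      (fun s : ℝ => (u s).re / (x - s) ^ a) x
  rw [zero_mul, one_mul, smul_eq_mul] at h1
  beta_reduce
  rw [← h1, ← intervalIntegral.integral_const_mul, ← intervalIntegral.integral_ofReal,
    intervalIntegral.integral_of_le zero_le_one, intervalIntegral.integral_of_le zero_le_one]
  refine setIntegral_congr_fun measurableSet_Ioc fun s hs => ?_
  have hsx : s * x ≤ x := mul_le_of_le_one_left hx.1.le hs.2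
  have hre : ((u ((s * x : ℝ) : ℂ)).re : ℂ) = u ((s * x : ℝ) : ℂ) :=
    Complex.ext (by simp) (him (s * x) (mul_pos hs.1 hx.1) (hsx.trans hx.2)).symm
  have hnn : 0 ≤ x - s * x := by linarith
  rw [Complex.ofReal_mul, Complex.ofReal_div, hre, div_eq_mul_inv, ← Complex.ofReal_inv,
    ← rpow_neg hnn, Complex.ofReal_cpow hnn]
  push_cast
  ring

/-- A fixed point of the integral equation solves the real and the complex problem. -/
theorem isSolution_of_eq_weightedMean (ha₀ : 0 < a) (ha₁ : a < 1) {b : ℝ} {f : ℝ → ℝ → ℝ}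
    {F : ℂ → ℂ → ℂ} (hfF : ∀ x ∈ Ioc (0 : ℝ) 1, ∀ y : ℝ, F (x : ℂ) (y : ℂ) = ((f x y : ℝ) : ℂ))
    (hR : 0 < R) (hR₁ : R ≤ 1)
    (hu : IsAdmissible R (insert 0 (closedCutDisc R)) (cutDisc R) u) (hu₀ : u 0 = b)
    (hφ : ContinuousOn φ (insert 0 (closedCutDisc R))) (hφ' : DifferentiableOn ℂ φ (cutDisc R))
    {M : ℝ} (hM : ∀ z ∈ insert 0 (closedCutDisc R), ‖φ z‖ ≤ M)
    (hφF : ∀ z ∈ closedCutDisc R, φ z = z ^ (a : ℂ) * F z (u z))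
    (huφ : ∀ z ∈ insert 0 (closedCutDisc R), u z = weightedMean (abelKernel a) φ z) :
    IsRealSolution a b f R (fun x : ℝ => (u (x : ℂ)).re) ∧ IsComplexSolution a (b : ℂ) F R u := by
  have hD := isStarPair_cutDisc hR
  have hmem : ∀ x ∈ Ioc 0 R, (x : ℂ) ∈ closedCutDisc R := fun x hx =>
    ⟨by simpa [abs_of_pos hx.1] using hx.2, Or.inl (by simpa using hx.1)⟩
  have hmem' : ∀ x ∈ Icc 0 R, (x : ℂ) ∈ insert 0 (closedCutDisc R) := fun x hx => by
    rcases hx.1.eq_or_lt with rfl | h0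
    · simp
    · exact Or.inr (hmem x ⟨h0, hx.2⟩)
  have hcancel : ∀ z : ℂ, z ≠ 0 → ∀ w, z ^ (-(a : ℂ)) * (z ^ (a : ℂ) * w) = w := fun z hz w => by
    rw [← mul_assoc, ← Complex.cpow_add _ _ hz, neg_add_cancel, Complex.cpow_zero, one_mul]
  refine ⟨⟨?_, by simp [hu₀], fun x hx => ?_⟩, ⟨hu.differentiableOn, hu.continuousOn, hu₀,
    fun z hz => ?_⟩⟩
  · exact Complex.continuous_re.comp_continuousOn
      (hu.continuousOn.comp Complex.continuous_ofReal.continuousOn hmem')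
  · have h1 := hasDerivWithinAt_complexFracIntegral_ray ha₀ ha₁ hD hφ huφ one_ne_zero (T := R)
      (t := x) (by simpa using hmem') hx
    have h2 := (Complex.reCLM.hasFDerivAt.comp_hasDerivWithinAt x h1)
    have hnhds : Ioc 0 R ∈ 𝓝[Icc 0 R] x := by
      have : Ioi (0 : ℝ) ∈ 𝓝[Icc 0 R] x := mem_nhdsWithin_of_mem_nhds (Ioi_mem_nhds hx.1)
      filter_upwards [this, self_mem_nhdsWithin] with s h1 h2 using ⟨h1, h2.2⟩
    have e : ∀ y ∈ Ioc 0 R, realFracIntegral a (fun x : ℝ => (u (x : ℂ)).re) y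
        = (complexFracIntegral a u (y * 1)).re := fun y hy => by
      rw [mul_one, ← ofReal_realFracIntegral hu.im_eq_zero hy, Complex.ofReal_re]
    refine (h2.congr_of_eventuallyEq ?_ (e x hx)).congr_deriv ?_
    · filter_upwards [hnhds] with y hy using e y hy
    · have hx0 : (x : ℂ) ≠ 0 := by exact_mod_cast hx.1.ne'
      have hre : (((u x).re : ℝ) : ℂ) = u x :=
        Complex.ext (by simp) (by simp [hu.im_eq_zero x hx.1 hx.2])
      rw [mul_one, hφF x (hmem x hx), Complex.ofReal_cpow hx.1.le, Complex.ofReal_neg,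
        hcancel _ hx0, ← hre, hfF x ⟨hx.1, hx.2.trans hR₁⟩]
      simp
  · have hz' : z ∈ closedCutDisc R := ⟨Metric.ball_subset_closedBall hz.1, hz.2⟩
    have := hasDerivAt_complexFracIntegral ha₀ ha₁ hR hφ hφ' hM huφ hz
    rwa [hφF z hz', hcancel z (Complex.slitPlane_ne_zero hz.2)] at this

end

/-! ### Successive approximations. -/

section

variable {a : ℝ} {R : ℝ} {Ω D : Set ℂ}

/-- By homogeneity, `|sz|^σ = s^σ |z|^σ`, so integrating the kernel produces exactly the moment of
order `σ`. -/
theorem norm_weightedMean_abelKernel_le (ha₀ : 0 < a) (ha₁ : a < 1) {h : ℂ → ℂ} {z : ℂ} {σ E : ℝ}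
    (hσ : 0 ≤ σ) (hle : ∀ s ∈ Ioc (0 : ℝ) 1, ‖h (s * z)‖ ≤ E * ‖(s : ℂ) * z‖ ^ σ) :
    ‖weightedMean (abelKernel a) h z‖ ≤ abelMoment a σ * E * ‖z‖ ^ σ := by
  have hi := intervalIntegrable_abelKernel_mul_rpow ha₀ ha₁ hσ
  have e : ∀ s, abelKernel a s * (s ^ σ * (E * ‖z‖ ^ σ))
      = abelKernel a s * s ^ σ * (E * ‖z‖ ^ σ) := fun s => by ring
  have h1 := norm_weightedMean_le (k := abelKernel a) (h := h) (z := z)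
    (B := fun s => s ^ σ * (E * ‖z‖ ^ σ)) (fun s hs => abelKernel_nonneg ha₀ hs)
    (by simp only [e]; exact hi.mul_const _) fun s hs => by
      refine (hle s hs).trans (le_of_eq ?_)
      rw [norm_mul, Complex.norm_real, norm_of_nonneg hs.1.le, mul_rpow hs.1.le (norm_nonneg _)]
      ring
  simp only [e] at h1
  rw [intervalIntegral.integral_mul_const] at h1
  rw [mul_assoc]
  exact h1

/-- Successive approximations for `w = weightedMean (abelKernel a) (N z (w z))`, starting from an
approximate solution `w₀` whose residual vanishes at the centre to an order `σ` so high that the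
map contracts the functions of that order. -/
theorem exists_eq_weightedMean (ha₀ : 0 < a) (ha₁ : a < 1) (hD : IsStarPair R Ω D)
    (hΩ : ∀ x : ℝ, 0 < x → x ≤ R → (x : ℂ) ∈ Ω) {N : ℂ → ℂ → ℂ} {r L M σ C : ℝ}
    (hN : ∀ w, IsAdmissible R Ω D w → (∀ z ∈ Ω, ‖w z‖ ≤ r) →
      IsAdmissible R Ω D fun z => N z (w z))
    (hM : ∀ z ∈ Ω, ∀ t, ‖t‖ ≤ r → ‖N z t‖ ≤ M)
    (hL₀ : 0 ≤ L) (hL : ∀ z ∈ Ω, ∀ t t', ‖t‖ ≤ r → ‖t'‖ ≤ r → ‖N z t - N z t'‖ ≤ L * ‖t - t'‖)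
    (hσ : 0 < σ) (hθ : L * abelMoment a σ < 1) {w₀ : ℂ → ℂ} (hw₀ : IsAdmissible R Ω D w₀)
    (hw₀r : ∀ z ∈ Ω, ‖w₀ z‖ ≤ r / 2) (hC₀ : 0 ≤ C)
    (hC : ∀ z ∈ Ω,
      ‖weightedMean (abelKernel a) (fun z => N z (w₀ z)) z - w₀ z‖ ≤ C * ‖z‖ ^ σ)
    (hsmall : C * R ^ σ / (1 - L * abelMoment a σ) ≤ r / 2) :
    ∃ w, IsAdmissible R Ω D w ∧ (∀ z ∈ Ω, ‖w z‖ ≤ r) ∧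
      (∀ z ∈ Ω, w z = weightedMean (abelKernel a) (fun z => N z (w z)) z) ∧
      (0 ∈ Ω → w 0 = w₀ 0) := by
  have hK := intervalIntegrable_abelKernel ha₀ ha₁
  have hΛ := abelMoment_pos ha₀ ha₁ hσ.le
  set θ := L * abelMoment a σ with hθdef
  have hθ₀ : 0 ≤ θ := mul_nonneg hL₀ hΛ.le
  have h1θ : 0 < 1 - θ := by linarith
  set T : (ℂ → ℂ) → ℂ → ℂ := fun w => weightedMean (abelKernel a) fun z => N z (w z) with hT
  have hTadm : ∀ w, IsAdmissible R Ω D w → (∀ z ∈ Ω, ‖w z‖ ≤ r) → IsAdmissible R Ω D (T w) :=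
    fun w hw hr => (hN w hw hr).weightedMean hD hK fun z hz => hM z hz _ (hr z hz)
  -- The exponent `τ` is left free: `τ = σ` drives the iteration, while `τ = 0`, where no
  -- contraction is needed, serves for the passage to the limit.
  have contr : ∀ w w', IsAdmissible R Ω D w → IsAdmissible R Ω D w' → (∀ z ∈ Ω, ‖w z‖ ≤ r) →
      (∀ z ∈ Ω, ‖w' z‖ ≤ r) → ∀ E τ : ℝ, 0 ≤ τ → (∀ z ∈ Ω, ‖w z - w' z‖ ≤ E * ‖z‖ ^ τ) →
      ∀ z ∈ Ω, ‖T w z - T w' z‖ ≤ abelMoment a τ * (L * E) * ‖z‖ ^ τ := by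
    intro w w' hw hw' hr hr' E τ hτ hE z hz
    rw [hT]
    simp only
    rw [hD.weightedMean_sub hK (hN w hw hr).continuousOn (hN w' hw' hr').continuousOn hz]
    refine norm_weightedMean_abelKernel_le ha₀ ha₁ hτ fun s hs => ?_
    have hs' := hD.mul_mem z hz s (Ioc_subset_Icc_self hs)
    refine (hL _ hs' _ _ (hr _ hs') (hr' _ hs')).trans ?_
    rw [mul_assoc]
    exact mul_le_mul_of_nonneg_left (hE _ hs') hL₀
  -- The partial sums of `∑ C θ^j`. Their bound `C/(1-θ)` and `hsmall` keep all iterates in the ball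
  -- of radius `r`.
  set B : ℕ → ℝ := fun n => C * (1 - θ ^ n) / (1 - θ) with hB
  have hnorm : ∀ z ∈ Ω, ‖z‖ ^ σ ≤ R ^ σ := fun z hz =>
    rpow_le_rpow (norm_nonneg _) (mem_closedBall_zero_iff.1 (hD.subset_closedBall hz)) hσ.le
  have hBr : ∀ (w : ℂ → ℂ) (n : ℕ), (∀ z ∈ Ω, ‖w z - w₀ z‖ ≤ B n * ‖z‖ ^ σ) → ∀ z ∈ Ω, ‖w z‖ ≤ r := by
    intro w n hw z hz
    have h1 := hw z hz
    have h2 : B n ≤ C / (1 - θ) := by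
      rw [hB]
      refine div_le_div_of_nonneg_right ?_ h1θ.le
      exact mul_le_of_le_one_right hC₀ (by linarith [pow_nonneg hθ₀ n])
    have h3 : B n * ‖z‖ ^ σ ≤ C / (1 - θ) * R ^ σ :=
      mul_le_mul h2 (hnorm z hz) (rpow_nonneg (norm_nonneg _) _) (by positivity)
    have h4 : C / (1 - θ) * R ^ σ = C * R ^ σ / (1 - θ) := by ring
    have h5 : ‖w z‖ ≤ ‖w z - w₀ z‖ + ‖w₀ z‖ := by
      simpa using norm_add_le (w z - w₀ z) (w₀ z)
    linarith [hw₀r z hz]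
  set W : ℕ → ℂ → ℂ := fun n => T^[n] w₀ with hW
  have hWs : ∀ n, W (n + 1) = T (W n) := fun n => Function.iterate_succ_apply' T n w₀
  have hB0 : B 0 = 0 := by simp [hB]
  have hBs : ∀ n, B (n + 1) = B n + C * θ ^ n := fun n => by
    simp only [hB]; field_simp; ring
  have hind : ∀ n, IsAdmissible R Ω D (W n) ∧ (∀ z ∈ Ω, ‖W n z - w₀ z‖ ≤ B n * ‖z‖ ^ σ) ∧
      ∀ z ∈ Ω, ‖W (n + 1) z - W n z‖ ≤ C * θ ^ n * ‖z‖ ^ σ := by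
    intro n
    induction n with
    | zero =>
      refine ⟨hw₀, fun z hz => by simp [hW, hB0], fun z hz => ?_⟩
      rw [hWs, pow_zero, mul_one]
      exact hC z hz
    | succ n ih =>
      obtain ⟨i1, i2, i3⟩ := ih
      have hr := hBr _ n i2
      have j1 : IsAdmissible R Ω D (W (n + 1)) := by rw [hWs]; exact hTadm _ i1 hr
      have j2 : ∀ z ∈ Ω, ‖W (n + 1) z - w₀ z‖ ≤ B (n + 1) * ‖z‖ ^ σ := fun z hz => by
        have := norm_add_le (W (n + 1) z - W n z) (W n z - w₀ z)
        rw [sub_add_sub_cancel] at this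
        rw [hBs]
        linarith [i2 z hz, i3 z hz]
      refine ⟨j1, j2, fun z hz => ?_⟩
      have := contr _ _ j1 i1 (hBr _ (n + 1) j2) hr _ σ hσ.le i3 z hz
      rw [← hWs, ← hWs] at this
      refine this.trans (le_of_eq ?_)
      rw [hθdef]; ring
  have hWr : ∀ n, ∀ z ∈ Ω, ‖W n z‖ ≤ r := fun n => hBr _ n (hind n).2.1
  set w : ℂ → ℂ := fun z => limUnder atTop fun n => W n z with hw
  have hdist : ∀ z ∈ Ω, ∀ n, dist (W n z) (W (n + 1) z) ≤ C * ‖z‖ ^ σ * θ ^ n := fun z hz n => by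
    rw [dist_comm, dist_eq_norm]
    refine ((hind n).2.2 z hz).trans (le_of_eq (by ring))
  have hlim : ∀ z ∈ Ω, Tendsto (fun n => W n z) atTop (𝓝 (w z)) := fun z hz =>
    (cauchySeq_of_le_geometric θ _ hθ (hdist z hz)).tendsto_limUnder
  have herr : ∀ n, ∀ z ∈ Ω, ‖W n z - w z‖ ≤ C * θ ^ n / (1 - θ) * ‖z‖ ^ σ := fun n z hz => by
    have := dist_le_of_le_geometric_of_tendsto θ _ hθ (hdist z hz) (hlim z hz) n
    rw [dist_eq_norm] at this
    refine this.trans (le_of_eq (by ring))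
  have hzero : Tendsto (fun n : ℕ => C * θ ^ n / (1 - θ) * R ^ σ) atTop (𝓝 0) := by
    have := ((tendsto_pow_atTop_nhds_zero_of_lt_one hθ₀ hθ).const_mul
      (C / (1 - θ) * R ^ σ))
    rw [mul_zero] at this
    refine this.congr fun n => by ring
  have herr' : ∀ n, ∀ z ∈ Ω, ‖W n z - w z‖ ≤ C * θ ^ n / (1 - θ) * R ^ σ := fun n z hz =>
    (herr n z hz).trans (mul_le_mul_of_nonneg_left (hnorm z hz) (by positivity))
  have hunif : TendstoUniformlyOn W w atTop Ω := by
    rw [Metric.tendstoUniformlyOn_iff]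
    intro ε hε
    filter_upwards [hzero.eventually (gt_mem_nhds hε)] with n hn z hz
    rw [dist_comm, dist_eq_norm]
    exact (herr' n z hz).trans_lt hn
  have hwadm : IsAdmissible R Ω D w := by
    refine ⟨hunif.continuousOn (Frequently.of_forall fun n => (hind n).1.continuousOn), ?_,
      fun x hx hxR => ?_⟩
    · exact (hunif.mono hD.subset).tendstoLocallyUniformlyOn.differentiableOn
        (Eventually.of_forall fun n => (hind n).1.differentiableOn) hD.isOpen
    · have h1 := (Complex.continuous_im.tendsto _).comp (hlim x (hΩ x hx hxR))
      refine tendsto_nhds_unique h1 (tendsto_const_nhds.congr fun n => ?_)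
      exact ((hind n).1.im_eq_zero x hx hxR).symm
  have hwr : ∀ z ∈ Ω, ‖w z‖ ≤ r := fun z hz =>
    le_of_tendsto (hlim z hz).norm (Eventually.of_forall fun n => hWr n z hz)
  refine ⟨w, hwadm, hwr, fun z hz => ?_, fun h0 => ?_⟩
  · refine tendsto_nhds_unique ((tendsto_add_atTop_iff_nat 1).2 (hlim z hz)) ?_
    rw [tendsto_iff_norm_sub_tendsto_zero]
    have h0 : Tendsto (fun n : ℕ =>
        abelMoment a 0 * (L * (C * θ ^ n / (1 - θ) * R ^ σ)) * ‖z‖ ^ (0 : ℝ)) atTop (𝓝 0) := by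
      have := ((hzero.const_mul L).const_mul (abelMoment a 0)).mul_const (‖z‖ ^ (0 : ℝ))
      simpa using this
    refine squeeze_zero (fun _ => norm_nonneg _) (fun n => ?_) h0
    rw [hWs]
    exact contr _ _ (hind n).1 hwadm (hWr n) hwr _ 0 le_rfl
      (fun z hz => by rw [rpow_zero, mul_one]; exact herr' n z hz) z hz
  -- The total correction is `O(|z|^σ)` and so vanishes at the centre.
  · have := herr 0 0 h0
    rw [norm_zero, zero_rpow hσ.ne', mul_zero, norm_le_zero_iff, sub_eq_zero] at this
    exact this.symm

end

/-! ### The reduced right-hand side and the analytic case. -/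

theorem eventually_mul_rpow_le (C σ ε : ℝ) (hσ : 0 < σ) (hε : 0 < ε) :
    ∀ᶠ R in 𝓝[>] (0 : ℝ), C * R ^ σ ≤ ε := by
  have h : Tendsto (fun R : ℝ => C * R ^ σ) (𝓝 0) (𝓝 (C * 0 ^ σ)) :=
    ((continuousAt_rpow_const 0 σ (Or.inr hσ.le)).tendsto).const_mul C
  rw [zero_rpow hσ.ne', mul_zero] at h
  filter_upwards [nhdsWithin_le_nhds (h.eventually (gt_mem_nhds hε))] with R hR using hR.le

/-- The right-hand side `N(z,t) = z^a F(z,b+t) - b/Γ(1-a)` of the problem for `u - b`. -/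
structure IsReducedRHS (a b : ℝ) (F : ℂ → ℂ → ℂ) (N : ℂ → ℂ → ℂ) : Prop where
  analytic : AnalyticOnNhd ℂ (fun p : ℂ × ℂ => N p.1 p.2) (Metric.ball 0 1 ×ˢ univ)
  add_eq : ∀ z ∈ Metric.ball (0 : ℂ) 1, z ≠ 0 → ∀ t : ℂ,
    N z t + ((b / Gamma (1 - a) : ℝ) : ℂ) = z ^ (a : ℂ) * F z (b + t)
  im_eq_zero : ∀ x : ℝ, 0 < x → x < 1 → ∀ y : ℝ, (N x y).im = 0

/-- The extension `G` of `z^a F` makes `N` analytic across `z = 0`. It is real on the real segment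
because `x^a` and `F` are. -/
theorem RegularRHS.exists_isReducedRHS {a b : ℝ} {f : ℝ → ℝ → ℝ}
    {F : ℂ → ℂ → ℂ} (hF : RegularRHS a F)
    (hfF : ∀ x ∈ Ioc (0 : ℝ) 1, ∀ y : ℝ, F (x : ℂ) (y : ℂ) = ((f x y : ℝ) : ℂ))
    {n : ℕ} {c : ℝ} {g : ℂ → ℂ} (hg : MemDiscSpace 1 g)
    (hbound : GrowthBound a b F n c g) :
    ∃ N, IsReducedRHS a b F N ∧
      ∀ z ∈ Metric.ball (0 : ℂ) 1, ∀ t, ‖N z t‖ ≤ c * ‖t‖ ^ n + ‖g z‖ := by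
  obtain ⟨G, hGa, -, hGF⟩ := hF.extension
  set β : ℂ := ((b / Gamma (1 - a) : ℝ) : ℂ) with hβ
  set N : ℂ → ℂ → ℂ := fun z t => G (z, b + t) - β with hN
  have hNa : AnalyticOnNhd ℂ (fun p : ℂ × ℂ => N p.1 p.2) (Metric.ball 0 1 ×ˢ univ) := by
    refine AnalyticOnNhd.sub ?_ analyticOnNhd_const
    refine hGa.comp (g := G) (f := fun p : ℂ × ℂ => (p.1, (b : ℂ) + p.2)) ?_ ?_
    · exact analyticOnNhd_fst.prod (analyticOnNhd_const.add analyticOnNhd_snd)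
    · intro p hp
      exact ⟨hp.1, mem_univ _⟩
  have hle : ∀ z ∈ Metric.ball (0 : ℂ) 1, z ≠ 0 → ∀ t, ‖N z t‖ ≤ c * ‖t‖ ^ n + ‖g z‖ := by
    intro z hz hz0 t
    have h := hbound z (Metric.ball_subset_closedBall hz) hz0 (b + t)
    rw [add_sub_cancel_left] at h
    refine le_trans (le_of_eq ?_) h
    rw [mul_sub, ← hGF z (Metric.ball_subset_closedBall hz) hz0, mul_left_comm,
      ← Complex.cpow_add _ _ hz0, add_neg_cancel, Complex.cpow_zero, mul_one]
  refine ⟨N, ⟨hNa, fun z hz hz0 t => ?_, fun x hx hx1 y => ?_⟩, fun z hz t => ?_⟩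
  · rw [← hGF z (Metric.ball_subset_closedBall hz) hz0]
    simp [hN, hβ]
  · have hx0 : (x : ℂ) ≠ 0 := by exact_mod_cast hx.ne'
    have hxm : (x : ℂ) ∈ Metric.closedBall (0 : ℂ) 1 := by simp [abs_of_pos hx, hx1.le]
    have := hfF x ⟨hx, hx1.le⟩ (b + y)
    rw [hN]
    simp only
    rw [hGF x hxm hx0, ← Complex.ofReal_add, this, ← Complex.ofReal_cpow hx.le, hβ,
      ← Complex.ofReal_mul, ← Complex.ofReal_sub, Complex.ofReal_im]
  -- At the centre the growth bound follows from the punctured disc by continuity.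
  · by_cases hz0 : z = 0
    · subst hz0
      have hNc : ContinuousAt (fun z => N z t) 0 := by
        have h1 : ContinuousAt (fun p : ℂ × ℂ => N p.1 p.2) (0, t) :=
          (hNa (0, t) ⟨hz, mem_univ _⟩).continuousAt
        exact h1.comp (f := fun z : ℂ => (z, t)) (by fun_prop)
      have hgc : ContinuousAt g 0 :=
        (hg.differentiableOn.differentiableAt (Metric.isOpen_ball.mem_nhds hz)).continuousAt
      refine le_of_tendsto_of_tendsto (b := 𝓝[≠] (0 : ℂ))
        (hNc.norm.tendsto.mono_left nhdsWithin_le_nhds)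
        ((hgc.norm.const_add _).tendsto.mono_left nhdsWithin_le_nhds) ?_
      filter_upwards [self_mem_nhdsWithin,
        nhdsWithin_le_nhds (Metric.isOpen_ball.mem_nhds hz)] with w hw1 hw2
      exact hle w hw2 hw1 t
    · exact hle z hz hz0 t

section

variable {a b : ℝ} {F N : ℂ → ℂ → ℂ} {R : ℝ} {Ω D : Set ℂ} {w : ℂ → ℂ}

theorem IsAdmissible.mono {Ω' D' : Set ℂ} (hw : IsAdmissible R Ω D w) (h₁ : Ω' ⊆ Ω)
    (h₂ : D' ⊆ D) : IsAdmissible R Ω' D' w :=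
  ⟨hw.continuousOn.mono h₁, hw.differentiableOn.mono h₂, hw.im_eq_zero⟩

theorem IsStarPair.subset_ball (hD : IsStarPair R Ω D) (hR : R < 1) :
    Ω ⊆ Metric.ball (0 : ℂ) 1 :=
  hD.subset_closedBall.trans (Metric.closedBall_subset_ball hR)

theorem IsReducedRHS.isAdmissible (hN : IsReducedRHS a b F N) (hD : IsStarPair R Ω D)
    (hR : R < 1) (hw : IsAdmissible R Ω D w) : IsAdmissible R Ω D fun z => N z (w z) where
  continuousOn := by
    refine hN.analytic.continuousOn.comp (f := fun z => (z, w z))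
      (continuousOn_id.prodMk hw.continuousOn) fun z hz => ⟨hD.subset_ball hR hz, mem_univ _⟩
  differentiableOn := by
    refine hN.analytic.differentiableOn.comp (f := fun z => (z, w z))
      (differentiableOn_id.prodMk hw.differentiableOn)
      fun z hz => ⟨hD.subset_ball hR (hD.subset hz), mem_univ _⟩
  im_eq_zero x hx hxR := by
    have : w x = ((w x).re : ℂ) := Complex.ext (by simp) (by simp [hw.im_eq_zero x hx hxR])
    rw [this]
    exact hN.im_eq_zero x hx (hxR.trans_lt hR) _

/-- For `φ = β + N(·,w)` with `β = b/Γ(1-a)`, the mean of `β` is `Γ(1-a) β = b`, so the fixed point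
equation for `w` becomes `u = Aφ` for `u = b + w`. -/
theorem IsReducedRHS.isSolution (hN : IsReducedRHS a b F N) (ha₀ : 0 < a) (ha₁ : a < 1)
    {f : ℝ → ℝ → ℝ}
    (hfF : ∀ x ∈ Ioc (0 : ℝ) 1, ∀ y : ℝ, F (x : ℂ) (y : ℂ) = ((f x y : ℝ) : ℂ))
    (hR : 0 < R) (hR₁ : R < 1)
    (hw : IsAdmissible R (insert 0 (closedCutDisc R)) (cutDisc R) w) (hw₀ : w 0 = 0) {M : ℝ}
    (hM : ∀ z ∈ insert 0 (closedCutDisc R), ‖N z (w z)‖ ≤ M)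
    (hwN : ∀ z ∈ insert 0 (closedCutDisc R),
      w z = weightedMean (abelKernel a) (fun z => N z (w z)) z) :
    IsRealSolution a b f R (fun x : ℝ => ((b : ℂ) + w (x : ℂ)).re) ∧
      IsComplexSolution a (b : ℂ) F R (fun z => (b : ℂ) + w z) := by
  have hD := isStarPair_cutDisc hR
  have hNw := hN.isAdmissible hD hR₁ hw
  set β : ℂ := ((b / Gamma (1 - a) : ℝ) : ℂ) with hβ
  have hG := (Gamma_pos_of_pos (show 0 < 1 - a by linarith)).ne'
  refine isSolution_of_eq_weightedMean (u := fun z => (b : ℂ) + w z)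
    (φ := fun z => β + N z (w z)) (M := ‖β‖ + M) ha₀ ha₁ hfF hR hR₁.le ?_ (by simp [hw₀])
    (continuousOn_const.add hNw.continuousOn) (hNw.differentiableOn.const_add β)
    (fun z hz => (norm_add_le _ _).trans (by linarith [hM z hz])) (fun z hz => ?_) fun z hz => ?_
  · exact ⟨continuousOn_const.add hw.continuousOn, hw.differentiableOn.const_add _,
      fun x hx hxR => by simp [hw.im_eq_zero x hx hxR]⟩
  · rw [add_comm]
    exact hN.add_eq z (hD.subset_ball hR₁ (Or.inr hz)) (Complex.slitPlane_ne_zero hz.2) _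
  · have hK := intervalIntegrable_abelKernel ha₀ ha₁
    rw [hD.weightedMean_add (h₁ := fun _ => β) hK continuousOn_const hNw.continuousOn hz,
      ← hwN z hz, weightedMean_const]
    have h0 := abelMoment_zero ha₀ ha₁
    simp only [abelMoment, rpow_zero, mul_one] at h0
    rw [h0, hβ, ← Complex.ofReal_mul, mul_div_cancel₀ _ hG]

theorem ofReal_mem_closedBall_zero (R x : ℝ) (hx : 0 < x) (hxR : x ≤ R) :
    (x : ℂ) ∈ Metric.closedBall (0 : ℂ) R := by
  simpa [abs_of_pos hx] using hxR

/-- If the linear part of the right-hand side is small at the centre, then there is an analytic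
solution. -/
theorem IsReducedRHS.exists_analytic_solution (hN : IsReducedRHS a b F N) (ha₀ : 0 < a)
    (ha₁ : a < 1) {κ : ℝ} (hκ₀ : 0 ≤ κ) (hκ : κ * Gamma (2 - a) < 1)
    (hκN : ∀ᶠ t in 𝓝 (0 : ℂ), ‖N 0 t‖ ≤ κ * ‖t‖) :
    ∃ R w M, 0 < R ∧ R < 1 ∧
      IsAdmissible R (Metric.closedBall 0 R) (Metric.ball 0 R) w ∧ w 0 = 0 ∧
      (∀ z ∈ Metric.closedBall (0 : ℂ) R, ‖N z (w z)‖ ≤ M) ∧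
      ∀ z ∈ Metric.closedBall (0 : ℂ) R,
        w z = weightedMean (abelKernel a) (fun z => N z (w z)) z := by
  have hΓ : 0 < Gamma (2 - a) := Gamma_pos_of_pos (by linarith)
  -- `κ` bounds the `t`-derivative of `N` at the origin; the margin `L - κ` absorbs the error of
  -- linearisation.
  obtain ⟨L, hκL, hL⟩ : ∃ L, κ < L ∧ L < 1 / Gamma (2 - a) :=
    exists_between (by rwa [lt_div_iff₀ hΓ])
  have hL₀ : 0 ≤ L := hκ₀.trans hκL.le
  have hθ : L * abelMoment a 1 < 1 := by
    rwa [abelMoment_one ha₀ ha₁, ← lt_div_iff₀ hΓ]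
  have hN00 : N 0 0 = 0 := by simpa using hκN.self_of_nhds
  have hmem : ((0 : ℂ), (0 : ℂ)) ∈ Metric.ball (0 : ℂ) 1 ×ˢ (univ : Set ℂ) := by simp
  have hstrict := (hN.analytic _ hmem).hasStrictFDerivAt
  set N' := fderiv ℂ (fun p : ℂ × ℂ => N p.1 p.2) (0, 0) with hN'
  have hd : HasDerivAt (fun t => N 0 t) (N' (0, 1)) 0 := by
    have h2 : HasDerivAt (fun t : ℂ => ((0 : ℂ), t)) (0, 1) 0 :=
      (hasDerivAt_const _ _).prodMk (hasDerivAt_id _)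
    exact hstrict.hasFDerivAt.comp_hasDerivAt (0 : ℂ) h2
  have hN'1 : ‖N' (0, 1)‖ ≤ κ := by
    refine hd.le_of_lip' hκ₀ ?_
    filter_upwards [hκN] with t ht
    simpa [hN00] using ht
  -- Strict differentiability in both variables gives the Lipschitz bound in `t` uniformly for `z`
  -- near `0`.
  have hlip := hstrict.isLittleO.def (sub_pos.2 hκL)
  obtain ⟨δ, hδ, hδN⟩ := Metric.eventually_nhds_iff.1 hlip
  have hlip' : ∀ z t t' : ℂ, ‖z‖ < δ → ‖t‖ < δ → ‖t'‖ < δ →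
      ‖N z t - N z t'‖ ≤ L * ‖t - t'‖ := by
    intro z t t' hz ht ht'
    have h1 := @hδN ((z, t), (z, t')) (by simp [Prod.dist_eq, hz, ht, ht'])
    simp only [Prod.mk_sub_mk, sub_self] at h1
    have h2 : N' (0, t - t') = (t - t') * N' (0, 1) := by
      rw [← smul_eq_mul, ← map_smul]; simp
    have h3 : ‖((0 : ℂ), t - t')‖ = ‖t - t'‖ := by simp [Prod.norm_def]
    have h4 : ‖N' (0, t - t')‖ ≤ κ * ‖t - t'‖ := by
      rw [h2, norm_mul, mul_comm]
      exact mul_le_mul_of_nonneg_right hN'1 (norm_nonneg _)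
    have h5 := norm_add_le (N z t - N z t' - N' (0, t - t')) (N' (0, t - t'))
    rw [sub_add_cancel] at h5
    rw [h3] at h1
    linarith
  -- The starting function `0` has a residual of order `1`, hence `σ = 1` below.
  have hz0 : ∃ C, 0 ≤ C ∧ ∀ᶠ z in 𝓝 (0 : ℂ), ‖N z 0‖ ≤ C * ‖z‖ := by
    have h2 : HasDerivAt (fun z : ℂ => (z, (0 : ℂ))) (1, 0) 0 :=
      (hasDerivAt_id _).prodMk (hasDerivAt_const _ _)
    have h3 := (HasFDerivAt.comp_hasDerivAt (f := fun z : ℂ => (z, (0 : ℂ))) (0 : ℂ)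
      hstrict.hasFDerivAt h2).isBigO_sub
    obtain ⟨C, hC, h4⟩ := h3.exists_pos
    refine ⟨C, hC.le, ?_⟩
    filter_upwards [h4.bound] with z hz
    simpa [hN00] using hz
  obtain ⟨C, hC, hCN⟩ := hz0
  obtain ⟨δ', hδ', hδN'⟩ := Metric.eventually_nhds_iff.1 hCN
  have hΛ : 0 < abelMoment a 1 := abelMoment_pos ha₀ ha₁ zero_le_one
  have h1θ : 0 < 1 - L * abelMoment a 1 := by linarith
  have hev := eventually_mul_rpow_le (abelMoment a 1 * C / (1 - L * abelMoment a 1)) 1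
    (δ / 2 / 2) one_pos (by positivity)
  have hev' : ∀ᶠ R in 𝓝[>] (0 : ℝ), R < min 1 (min δ δ') :=
    nhdsWithin_le_nhds (gt_mem_nhds (by positivity))
  obtain ⟨R, hR₁, hR₂, hR₀⟩ := (hev.and (hev'.and self_mem_nhdsWithin)).exists
  simp only [lt_min_iff] at hR₂
  have hR₀' : (0 : ℝ) < R := hR₀
  have hnorm : ∀ z ∈ Metric.closedBall (0 : ℂ) R, ‖z‖ ≤ R := fun z hz => by simpa using hz
  have hCz : ∀ z ∈ Metric.closedBall (0 : ℂ) R, ‖N z 0‖ ≤ C * ‖z‖ := fun z hz =>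
    @hδN' z (by simpa using (hnorm z hz).trans_lt hR₂.2.2)
  have hM : ∀ z ∈ Metric.closedBall (0 : ℂ) R, ∀ t, ‖t‖ ≤ δ / 2 →
      ‖N z t‖ ≤ C * R + L * (δ / 2) := fun z hz t ht => by
    have h1 := hlip' z t 0 ((hnorm z hz).trans_lt hR₂.2.1) (by linarith) (by simpa using hδ)
    have h2 := norm_add_le (N z t - N z 0) (N z 0)
    rw [sub_add_cancel] at h2
    rw [sub_zero] at h1
    have h3 := mul_le_mul_of_nonneg_left (hnorm z hz) hC
    have h4 := mul_le_mul_of_nonneg_left ht hL₀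
    linarith [hCz z hz]
  have hD := isStarPair_ball R
  obtain ⟨w, hw, hwr, hwN, hw0⟩ := exists_eq_weightedMean ha₀ ha₁ hD (ofReal_mem_closedBall_zero R)
    (N := N) (r := δ / 2) (L := L) (M := C * R + L * (δ / 2)) (σ := 1) (C := abelMoment a 1 * C)
    (fun w hw _ => hN.isAdmissible hD hR₂.1 hw) hM hL₀
    (fun z hz t t' ht ht' => hlip' z t t' ((hnorm z hz).trans_lt hR₂.2.1) (by linarith)
      (by linarith)) one_pos hθ (w₀ := fun _ => 0)
    ⟨continuousOn_const, differentiableOn_const _, fun _ _ _ => rfl⟩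
    (fun z _ => by rw [norm_zero]; positivity) (by positivity)
    (fun z hz => by
      rw [sub_zero]
      refine norm_weightedMean_abelKernel_le ha₀ ha₁ zero_le_one fun s hs => ?_
      rw [rpow_one]
      exact hCz _ (hD.mul_mem z hz s (Ioc_subset_Icc_self hs)))
    (by rw [div_mul_eq_mul_div] at hR₁; exact hR₁)
  exact ⟨R, w, _, hR₀', hR₂.1, hw, hw0 (by simpa using hR₀'.le),
    fun z hz => hM z hz _ (hwr z hz), hwN⟩

end

/-! ### The affine case: formal solutions, resonance and the logarithm. -/

/-- An entire function of linear growth is affine. -/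
theorem Differentiable.eq_affine_of_norm_le {f : ℂ → ℂ} (hf : Differentiable ℂ f) {A B : ℝ}
    (hle : ∀ t, ‖f t‖ ≤ A * ‖t‖ + B) (t : ℂ) : f t = f 0 + (f 1 - f 0) * t := by
  -- The difference quotient at `0` is entire and bounded, hence constant by Liouville's theorem.
  have hd : Differentiable ℂ (dslope f 0) := by
    rw [← differentiableOn_univ] at hf ⊢
    exact (Complex.differentiableOn_dslope univ_mem).2 hf
  have hbdd : Bornology.IsBounded (range (dslope f 0)) := by
    obtain ⟨M, hM⟩ := (isCompact_closedBall (0 : ℂ) 1).exists_bound_of_continuousOn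
      hd.continuous.continuousOn
    have hB : 0 ≤ B := by simpa using (norm_nonneg _).trans (hle 0)
    refine isBounded_iff_forall_norm_le.2 ⟨max M (A + B + B), ?_⟩
    rintro _ ⟨t, rfl⟩
    by_cases ht : ‖t‖ ≤ 1
    · exact le_max_of_le_left (hM t (by simpa using ht))
    · rw [not_le] at ht
      have ht0 : t ≠ 0 := norm_pos_iff.1 (by linarith)
      refine le_max_of_le_right ?_
      rw [dslope_of_ne _ ht0, slope_def_field, sub_zero, norm_div, div_le_iff₀ (by linarith)]
      have h1 := norm_sub_le (f t) (f 0)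
      have h2 := hle t
      have h3 : ‖f 0‖ ≤ B := by simpa using hle 0
      nlinarith
  have h1 : ∀ t, dslope f 0 t = dslope f 0 1 := fun t => hd.apply_eq_apply_of_bounded hbdd t 1
  have h2 : dslope f 0 1 = f 1 - f 0 := by
    rw [dslope_of_ne _ one_ne_zero, slope_def_field]; simp
  have h3 := sub_smul_dslope f 0 t
  rw [h1, h2, sub_zero, smul_eq_mul] at h3
  linear_combination -h3

section

variable {a R : ℝ} {Ω D : Set ℂ} {w v : ℂ → ℂ}

namespace IsAdmissible

theorem const (c : ℝ) : IsAdmissible R Ω D fun _ => (c : ℂ) :=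
  ⟨continuousOn_const, differentiableOn_const _, fun _ _ _ => Complex.ofReal_im c⟩

theorem add (hw : IsAdmissible R Ω D w) (hv : IsAdmissible R Ω D v) :
    IsAdmissible R Ω D fun z => w z + v z :=
  ⟨hw.continuousOn.add hv.continuousOn, hw.differentiableOn.add hv.differentiableOn,
    fun x hx hxR => by simp [hw.im_eq_zero x hx hxR, hv.im_eq_zero x hx hxR]⟩

theorem sub (hw : IsAdmissible R Ω D w) (hv : IsAdmissible R Ω D v) :
    IsAdmissible R Ω D fun z => w z - v z :=
  ⟨hw.continuousOn.sub hv.continuousOn, hw.differentiableOn.sub hv.differentiableOn,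
    fun x hx hxR => by simp [hw.im_eq_zero x hx hxR, hv.im_eq_zero x hx hxR]⟩

theorem mul (hw : IsAdmissible R Ω D w) (hv : IsAdmissible R Ω D v) :
    IsAdmissible R Ω D fun z => w z * v z :=
  ⟨hw.continuousOn.mul hv.continuousOn, hw.differentiableOn.mul hv.differentiableOn,
    fun x hx hxR => by simp [hw.im_eq_zero x hx hxR, hv.im_eq_zero x hx hxR]⟩

theorem pow (k : ℕ) : IsAdmissible R Ω D fun z => z ^ k :=
  ⟨by fun_prop, by fun_prop, fun x _ _ => by rw [← Complex.ofReal_pow, Complex.ofReal_im]⟩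

theorem restrict {R' : ℝ} (hw : IsAdmissible R Ω D w) (hR : R' ≤ R) :
    IsAdmissible R' Ω D w :=
  ⟨hw.continuousOn, hw.differentiableOn, fun x hx hxR => hw.im_eq_zero x hx (hxR.trans hR)⟩

/-- Realness on `(0,R]` passes to the centre by continuity; this keeps the coefficients of the
approximate solutions real. -/
theorem im_zero_eq_zero (hR : 0 < R)
    (hw : IsAdmissible R (Metric.closedBall 0 R) (Metric.ball 0 R) w) : (w 0).im = 0 := by
  have h1 : ContinuousWithinAt (fun x : ℝ => (w x).im) (Ioc 0 R) 0 := by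
    have h := (Complex.continuous_im.comp_continuousOn hw.continuousOn).comp
      (f := fun x : ℝ => (x : ℂ)) (s := Icc 0 R) Complex.continuous_ofReal.continuousOn
      fun x hx => by simpa [abs_of_nonneg hx.1] using hx.2
    exact (h 0 (by simp [hR.le])).mono Ioc_subset_Icc_self
  have : (𝓝[Ioc 0 R] (0 : ℝ)).NeBot := by
    rw [← mem_closure_iff_nhdsWithin_neBot, closure_Ioc hR.ne]
    simp [hR.le]
  have h2 : Tendsto (fun x : ℝ => (w x).im) (𝓝[Ioc 0 R] 0) (𝓝 0) := by
    refine tendsto_const_nhds.congr' ?_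
    filter_upwards [self_mem_nhdsWithin] with x hx
    exact (hw.im_eq_zero x hx.1 hx.2).symm
  have := tendsto_nhds_unique h1.tendsto h2
  simpa using this

/-- The quotient by `z` is the difference quotient at the removable singularity. Each coefficient
made to vanish thus gains one order. -/
theorem exists_eq_mul (hR : 0 < R)
    (hw : IsAdmissible R (Metric.closedBall 0 R) (Metric.ball 0 R) w) (hw₀ : w 0 = 0) :
    ∃ v, IsAdmissible R (Metric.closedBall 0 R) (Metric.ball 0 R) v ∧ ∀ z, w z = z * v z := by
  have he : ∀ z, w z = z * dslope w 0 z := fun z => by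
    have := sub_smul_dslope w 0 z
    rw [hw₀, sub_zero, sub_zero, smul_eq_mul] at this
    exact this.symm
  have hb : Metric.ball (0 : ℂ) R ∈ 𝓝 0 := Metric.ball_mem_nhds _ hR
  refine ⟨dslope w 0, ⟨?_, ?_, fun x hx hxR => ?_⟩, he⟩
  · exact (continuousOn_dslope (Metric.closedBall_mem_nhds _ hR)).2
      ⟨hw.continuousOn, hw.differentiableOn.differentiableAt hb⟩
  · exact (Complex.differentiableOn_dslope hb).2 hw.differentiableOn
  · have h1 := hw.im_eq_zero x hx hxR
    rw [he, Complex.im_ofReal_mul] at h1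
    exact (mul_eq_zero.1 h1).resolve_left hx.ne'

theorem exists_norm_le (hw : IsAdmissible R (Metric.closedBall 0 R) (Metric.ball 0 R) w) :
    ∃ M, 0 ≤ M ∧ ∀ z ∈ Metric.closedBall (0 : ℂ) R, ‖w z‖ ≤ M := by
  obtain ⟨M, hM⟩ := (isCompact_closedBall (0 : ℂ) R).exists_bound_of_continuousOn hw.continuousOn
  exact ⟨max M 0, le_max_right _ _, fun z hz => (hM z hz).trans (le_max_left _ _)⟩

theorem weightedMean_ball {k : ℝ → ℝ} (hk : IntervalIntegrable k volume 0 1)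
    (hw : IsAdmissible R (Metric.closedBall 0 R) (Metric.ball 0 R) w) :
    IsAdmissible R (Metric.closedBall 0 R) (Metric.ball 0 R) (_root_.weightedMean k w) := by
  obtain ⟨M, -, hM⟩ := hw.exists_norm_le
  exact hw.weightedMean (isStarPair_ball R) hk hM

end IsAdmissible

theorem weightedMean_pow_mul (k : ℝ → ℝ) (h : ℂ → ℂ) (n : ℕ) (z : ℂ) :
    weightedMean k (fun z => z ^ n * h z) z
      = z ^ n * weightedMean (fun s => k s * s ^ n) h z := by
  unfold weightedMean
  rw [← intervalIntegral.integral_const_mul]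
  congr 1
  ext s
  push_cast
  ring

theorem weightedMean_apply_zero (k : ℝ → ℝ) (h : ℂ → ℂ) :
    weightedMean k h 0 = ((∫ s in (0 : ℝ)..1, k s : ℝ) : ℂ) * h 0 := by
  simp only [weightedMean, mul_zero]
  rw [intervalIntegral.integral_mul_const, intervalIntegral.integral_ofReal]

theorem intervalIntegrable_abelKernel_mul_pow (ha₀ : 0 < a) (ha₁ : a < 1) (k : ℕ) :
    IntervalIntegrable (fun s => abelKernel a s * s ^ k) volume 0 1 := by
  simpa using intervalIntegrable_abelKernel_mul_rpow ha₀ ha₁ (Nat.cast_nonneg (α := ℝ) k)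

theorem integral_abelKernel_mul_pow (k : ℕ) :
    ∫ s in (0 : ℝ)..1, abelKernel a s * s ^ k = abelMoment a k := by
  simp [abelMoment]

/-- Polynomial approximate solutions of `w = weightedMean (abelKernel a) (p + q w)`, as long as
there is no resonance. -/
theorem exists_approximate_solution_pow (ha₀ : 0 < a) (ha₁ : a < 1) {ρ : ℝ} (hρ : 0 < ρ)
    {p q : ℂ → ℂ} (hp : IsAdmissible ρ (Metric.closedBall 0 ρ) (Metric.ball 0 ρ) p)
    (hq : IsAdmissible ρ (Metric.closedBall 0 ρ) (Metric.ball 0 ρ) q) (hp₀ : p 0 = 0)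
    {k : ℕ} (hk : 1 ≤ k) (hres : ∀ j : ℕ, 1 ≤ j → j < k → (q 0).re * abelMoment a j ≠ 1) :
    ∃ P r, IsAdmissible ρ (Metric.closedBall 0 ρ) (Metric.ball 0 ρ) P ∧
      IsAdmissible ρ (Metric.closedBall 0 ρ) (Metric.ball 0 ρ) r ∧ P 0 = 0 ∧
      ∀ z ∈ Metric.closedBall (0 : ℂ) ρ,
        P z - weightedMean (abelKernel a) (fun z => p z + q z * P z) z = z ^ k * r z := by
  have hK := intervalIntegrable_abelKernel ha₀ ha₁
  have hD := isStarPair_ball ρ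
  induction k, hk using Nat.le_induction with
  | base =>
    obtain ⟨v, hv, hv'⟩ := (hp.weightedMean_ball hK).exists_eq_mul hρ
      (by rw [weightedMean_apply_zero, hp₀, mul_zero])
    refine ⟨fun _ => ((0 : ℝ) : ℂ), fun z => ((0 : ℝ) : ℂ) - v z, IsAdmissible.const 0,
      (IsAdmissible.const 0).sub hv, by simp, fun z _ => ?_⟩
    simp [hv']
  | succ k hk ih =>
    obtain ⟨P, r, hP, hr, hP0, hPr⟩ := ih fun j h1 h2 => hres j h1 (by omega)
    have hne := hres k hk (by omega)
    have hKk := intervalIntegrable_abelKernel_mul_pow ha₀ ha₁ k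
    -- Subtracting `γ z^k` from `P` changes the leading residual coefficient to `r(0) - γ + γ q(0)
    -- Λ_k`; this `γ` makes it zero.
    set γ : ℝ := (r 0).re / (1 - (q 0).re * abelMoment a k) with hγ
    have hr0 : r 0 = ((r 0).re : ℂ) := Complex.ext (by simp) (by simp [hr.im_zero_eq_zero hρ])
    have hq0 : q 0 = ((q 0).re : ℂ) := Complex.ext (by simp) (by simp [hq.im_zero_eq_zero hρ])
    have hA := hq.weightedMean_ball hKk
    have hr' : IsAdmissible ρ (Metric.closedBall 0 ρ) (Metric.ball 0 ρ) fun z =>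
        (r z - (γ : ℂ)) + (γ : ℂ) * weightedMean (fun s => abelKernel a s * s ^ k) q z :=
      (hr.sub (IsAdmissible.const γ)).add ((IsAdmissible.const γ).mul hA)
    obtain ⟨v, hv, hv'⟩ := hr'.exists_eq_mul hρ (by
      rw [weightedMean_apply_zero, integral_abelKernel_mul_pow, hr0, hq0]
      have h1 : (1 - (q 0).re * abelMoment a k) ≠ 0 := fun h => hne (by linarith)
      have h2 : (r 0).re - γ + γ * (abelMoment a k * (q 0).re) = 0 := by
        rw [hγ]; field_simp; ring
      exact_mod_cast h2)
    refine ⟨fun z => P z - (γ : ℂ) * z ^ k, v,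
      hP.sub ((IsAdmissible.const γ).mul (IsAdmissible.pow k)), hv, ?_, fun z hz => ?_⟩
    · simp [hP0, show k ≠ 0 by omega]
    · have e : weightedMean (abelKernel a) (fun z => p z + q z * (P z - (γ : ℂ) * z ^ k)) z
          = weightedMean (abelKernel a) (fun z => p z + q z * P z) z
          - weightedMean (abelKernel a) (fun z => (γ : ℂ) * (z ^ k * q z)) z := by
        rw [hD.weightedMean_sub hK (hp.add (hq.mul hP)).continuousOn
          ((IsAdmissible.const γ).mul ((IsAdmissible.pow k).mul hq)).continuousOn hz]
        congr 1
        ext z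
        ring
      rw [e, weightedMean_const_mul, weightedMean_pow_mul, pow_succ, mul_assoc, ← hv' z]
      linear_combination hPr z hz

/-- The `2` bounds `|log |z|| |z|^(1/2)`, the `π` bounds the argument. -/
theorem norm_log_mul_rpow_le {z : ℂ} (hz : z ≠ 0) (hz₁ : ‖z‖ ≤ 1) :
    ‖Complex.log z‖ * ‖z‖ ^ (1 / 2 : ℝ) ≤ 2 + π := by
  have hpos := norm_pos_iff.2 hz
  have h1 := abs_log_mul_self_rpow_lt ‖z‖ (1 / 2) hpos hz₁ (by norm_num)
  have h2 : ‖z‖ ^ (1 / 2 : ℝ) ≤ 1 := rpow_le_one hpos.le hz₁ (by norm_num)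
  have h0 : 0 ≤ ‖z‖ ^ (1 / 2 : ℝ) := rpow_nonneg hpos.le _
  have h3 : ‖Complex.log z‖ ≤ |log ‖z‖| + π := by
    refine (Complex.norm_le_abs_re_add_abs_im _).trans ?_
    rw [Complex.log_re, Complex.log_im]
    linarith [Complex.abs_arg_le_pi z]
  rw [abs_mul, abs_of_nonneg h0] at h1
  nlinarith [pi_pos]

/-- Near the centre `|z^k log z| ≤ (2+π) |z|^(1/2)`; elsewhere the slit keeps the logarithm
analytic. -/
theorem isAdmissible_pow_mul_log {ρ : ℝ} (hρ₁ : ρ ≤ 1) {k : ℕ} (hk : 1 ≤ k) :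
    IsAdmissible ρ (insert 0 (closedCutDisc ρ)) (cutDisc ρ) fun z => z ^ k * Complex.log z where
  continuousOn := by
    rintro z (rfl | hz)
    · have h1 : Tendsto (fun z : ℂ => (2 + π) * ‖z‖ ^ (1 / 2 : ℝ))
          (𝓝[insert 0 (closedCutDisc ρ)] 0) (𝓝 0) := by
        have : ContinuousAt (fun z : ℂ => (2 + π) * ‖z‖ ^ (1 / 2 : ℝ)) 0 :=
          continuousAt_const.mul (continuous_norm.continuousAt.rpow_const (Or.inr (by norm_num)))
        have h := this.tendsto
        simp only [norm_zero] at h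
        rw [zero_rpow (by norm_num), mul_zero] at h
        exact h.mono_left nhdsWithin_le_nhds
      have h2 : Tendsto (fun z : ℂ => z ^ k * Complex.log z)
          (𝓝[insert 0 (closedCutDisc ρ)] 0) (𝓝 0) := by
        refine squeeze_zero_norm' ?_ h1
        filter_upwards [self_mem_nhdsWithin] with z hz
        rcases hz with rfl | hz
        · simp [show k ≠ 0 by omega]
        · have hz0 := Complex.slitPlane_ne_zero hz.2
          have hz1 : ‖z‖ ≤ 1 := (mem_closedBall_zero_iff.1 hz.1).trans hρ₁
          have h3 := norm_log_mul_rpow_le hz0 hz1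
          have h0 : 0 ≤ ‖z‖ ^ (1 / 2 : ℝ) := rpow_nonneg (norm_nonneg z) _
          have h4 : ‖z‖ ^ k ≤ ‖z‖ ^ (1 / 2 : ℝ) * ‖z‖ ^ (1 / 2 : ℝ) := by
            rw [← rpow_add (norm_pos_iff.2 hz0)]
            norm_num
            exact pow_le_of_le_one (norm_nonneg _) hz1 (by omega)
          rw [norm_mul, norm_pow]
          calc ‖z‖ ^ k * ‖Complex.log z‖
              ≤ ‖z‖ ^ (1 / 2 : ℝ) * ‖z‖ ^ (1 / 2 : ℝ) * ‖Complex.log z‖ :=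
                mul_le_mul_of_nonneg_right h4 (norm_nonneg _)
            _ = ‖Complex.log z‖ * ‖z‖ ^ (1 / 2 : ℝ) * ‖z‖ ^ (1 / 2 : ℝ) := by ring
            _ ≤ _ := mul_le_mul_of_nonneg_right h3 h0
      have h5 : (fun z : ℂ => z ^ k * Complex.log z) 0 = 0 := by simp
      unfold ContinuousWithinAt
      rw [h5]
      exact h2
    · exact ((continuous_pow k).continuousAt.mul (continuousAt_clog hz.2)).continuousWithinAt
  differentiableOn z hz :=
    ((differentiableAt_id.pow k).mul (differentiableAt_id.clog hz.2)).differentiableWithinAt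
  im_eq_zero x hx _ := by
    rw [← Complex.ofReal_log hx.le, ← Complex.ofReal_pow, ← Complex.ofReal_mul, Complex.ofReal_im]

end

section

variable {a : ℝ}

theorem insert_closedCutDisc_subset {R : ℝ} (hR : 0 ≤ R) :
    insert 0 (closedCutDisc R) ⊆ Metric.closedBall (0 : ℂ) R :=
  insert_subset (by simpa using hR) inter_subset_left

/-- For `s > 0` one has `log(sz) = log s + log z`, which separates a logarithmic and a log-free
part. -/
theorem weightedMean_mul_pow_mul_log (ha₀ : 0 < a) (ha₁ : a < 1) {R : ℝ} {q : ℂ → ℂ}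
    (hq : ContinuousOn q (Metric.closedBall 0 R)) {k : ℕ} (hk : 1 ≤ k) {z : ℂ}
    (hz : z ∈ Metric.closedBall 0 R) (hz₀ : z ≠ 0) :
    weightedMean (abelKernel a) (fun z => q z * (z ^ k * Complex.log z)) z
      = z ^ k * (Complex.log z * weightedMean (fun s => abelKernel a s * s ^ k) q z
        + weightedMean (fun s => abelKernel a s * (s ^ k * log s)) q z) := by
  have hD := isStarPair_ball R
  have i1 := hD.intervalIntegrable (intervalIntegrable_abelKernel_mul_pow ha₀ ha₁ k) hq hz
  have i2 := hD.intervalIntegrable (intervalIntegrable_abelKernel_mul_pow_mul_log ha₀ ha₁ hk) hq hz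
  unfold weightedMean
  rw [← intervalIntegral.integral_const_mul, ← intervalIntegral.integral_add (i1.const_mul _) i2,
    ← intervalIntegral.integral_const_mul,
    intervalIntegral.integral_of_le zero_le_one, intervalIntegral.integral_of_le zero_le_one]
  refine setIntegral_congr_fun measurableSet_Ioc fun s hs => ?_
  simp only
  rw [Complex.log_ofReal_mul hs.1 hz₀]
  push_cast
  ring

/-- Approximate solutions of `w = weightedMean (abelKernel a) (p + q w)` at a resonance, with a
logarithmic term. -/
theorem exists_approximate_solution_log (ha₀ : 0 < a) (ha₁ : a < 1) {ρ : ℝ} (hρ : 0 < ρ)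
    (hρ₁ : ρ ≤ 1) {p q P r : ℂ → ℂ}
    (hp : IsAdmissible ρ (Metric.closedBall 0 ρ) (Metric.ball 0 ρ) p)
    (hq : IsAdmissible ρ (Metric.closedBall 0 ρ) (Metric.ball 0 ρ) q)
    (hP : IsAdmissible ρ (Metric.closedBall 0 ρ) (Metric.ball 0 ρ) P)
    (hr : IsAdmissible ρ (Metric.closedBall 0 ρ) (Metric.ball 0 ρ) r) (hP₀ : P 0 = 0)
    {k : ℕ} (hk : 1 ≤ k)
    (hPr : ∀ z ∈ Metric.closedBall (0 : ℂ) ρ,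
      P z - weightedMean (abelKernel a) (fun z => p z + q z * P z) z = z ^ k * r z)
    (hres : (q 0).re * abelMoment a k = 1) :
    ∃ w₀ C, IsAdmissible ρ (insert 0 (closedCutDisc ρ)) (cutDisc ρ) w₀ ∧ w₀ 0 = 0 ∧ 0 ≤ C ∧
      ∀ z ∈ insert 0 (closedCutDisc ρ),
        ‖weightedMean (abelKernel a) (fun z => p z + q z * w₀ z) z - w₀ z‖
          ≤ C * ‖z‖ ^ ((k : ℝ) + 1 / 2) := by
  have hK := intervalIntegrable_abelKernel ha₀ ha₁
  have hKk := intervalIntegrable_abelKernel_mul_pow ha₀ ha₁ k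
  have hKl := intervalIntegrable_abelKernel_mul_pow_mul_log ha₀ ha₁ hk
  have hDc := isStarPair_cutDisc hρ
  have hsub := insert_closedCutDisc_subset hρ.le
  have hsub' : cutDisc ρ ⊆ Metric.ball 0 ρ := inter_subset_left
  set m := ∫ s in (0 : ℝ)..1, abelKernel a s * (s ^ k * log s) with hm
  have hm₀ : m < 0 := integral_abelKernel_mul_pow_mul_log_neg ha₀ hKl
  have hκ₀ : (q 0).re ≠ 0 := fun h => by rw [h, zero_mul] at hres; exact zero_ne_one hres
  -- For `P - γ z^k log z` the residual has leading log-free coefficient `r(0) + γ m q(0)`, which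
  -- `γ` cancels as `m ≠ 0`. The coefficient `γ (q(0) Λ_k - 1)` of `z^k log z` vanishes by
  -- resonance.
  set γ : ℝ := -(r 0).re / ((q 0).re * m) with hγ
  have hr0 : r 0 = ((r 0).re : ℂ) := Complex.ext (by simp) (by simp [hr.im_zero_eq_zero hρ])
  have hq0 : q 0 = ((q 0).re : ℂ) := Complex.ext (by simp) (by simp [hq.im_zero_eq_zero hρ])
  obtain ⟨v₁, hv₁, hv₁'⟩ := (hr.add ((IsAdmissible.const γ).mul
    (hq.weightedMean_ball hKl))).exists_eq_mul hρ (by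
      rw [weightedMean_apply_zero, hr0, hq0]
      have h2 : (r 0).re + γ * (m * (q 0).re) = 0 := by
        have := hm₀.ne
        rw [hγ]; field_simp; ring
      exact_mod_cast h2)
  obtain ⟨v₂, hv₂, hv₂'⟩ := ((hq.weightedMean_ball hKk).sub
    (IsAdmissible.const 1)).exists_eq_mul hρ (by
      rw [weightedMean_apply_zero, integral_abelKernel_mul_pow, hq0, mul_comm]
      exact_mod_cast sub_eq_zero.2 hres)
  obtain ⟨M₁, hM₁₀, hM₁⟩ := hv₁.exists_norm_le
  obtain ⟨M₂, hM₂₀, hM₂⟩ := hv₂.exists_norm_le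
  have hl := isAdmissible_pow_mul_log hρ₁ hk
  have hPc := hP.mono hsub hsub'
  have hpc := hp.mono hsub hsub'
  have hqc := hq.mono hsub hsub'
  have hγl := (IsAdmissible.const γ).mul hl
  refine ⟨fun z => P z - (γ : ℂ) * (z ^ k * Complex.log z), M₁ + |γ| * (M₂ * (2 + π)),
    hPc.sub hγl, by simp [hP₀], by have := pi_pos; positivity, fun z hz => ?_⟩
  have hzb := hsub hz
  by_cases hz0 : z = 0
  · subst hz0
    have h1 := hPr 0 (hsub hz)
    have h0 : k ≠ 0 := by omega
    rw [weightedMean_apply_zero, hP₀, zero_pow h0, zero_mul, zero_sub, neg_eq_zero] at h1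
    rw [weightedMean_apply_zero]
    simp only [hP₀, Complex.log_zero, mul_zero, sub_zero] at h1 ⊢
    rw [h1, norm_zero, zero_rpow (by positivity), mul_zero]
  have e : weightedMean (abelKernel a)
        (fun z => p z + q z * (P z - (γ : ℂ) * (z ^ k * Complex.log z))) z
      = weightedMean (abelKernel a) (fun z => p z + q z * P z) z
      - weightedMean (abelKernel a) (fun z => (γ : ℂ) * (q z * (z ^ k * Complex.log z))) z := by
    rw [hDc.weightedMean_sub hK (hpc.add (hqc.mul hPc)).continuousOn
      ((IsAdmissible.const γ).mul (hqc.mul hl)).continuousOn hz]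
    congr 1
    ext z
    ring
  have e2 : weightedMean (abelKernel a)
        (fun z => p z + q z * (P z - (γ : ℂ) * (z ^ k * Complex.log z))) z
        - (P z - (γ : ℂ) * (z ^ k * Complex.log z))
      = -(z ^ k * (z * v₁ z + (γ : ℂ) * Complex.log z * (z * v₂ z))) := by
    rw [e, weightedMean_const_mul,
      weightedMean_mul_pow_mul_log ha₀ ha₁ hq.continuousOn hk hzb hz0, ← hv₁', ← hv₂']
    push_cast
    linear_combination -hPr z hzb
  rw [e2, norm_neg, norm_mul, norm_pow]
  have hpos := norm_pos_iff.2 hz0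
  have hz1 : ‖z‖ ≤ 1 := (mem_closedBall_zero_iff.1 hzb).trans hρ₁
  -- Of the extra factor `|z| = x²`, one `x` absorbs the logarithm and the other supplies the
  -- additional half order.
  set x := ‖z‖ ^ (1 / 2 : ℝ) with hx
  have hx0 : 0 ≤ x := rpow_nonneg hpos.le _
  have hx1 : x ≤ 1 := rpow_le_one hpos.le hz1 (by norm_num)
  have hxx : ‖z‖ = x * x := by
    rw [hx, ← rpow_add hpos]; norm_num
  have hlog := norm_log_mul_rpow_le hz0 hz1
  rw [rpow_add hpos, rpow_natCast, mul_left_comm (M₁ + _)]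
  refine mul_le_mul_of_nonneg_left ?_ (by positivity)
  refine (norm_add_le _ _).trans ?_
  rw [norm_mul, norm_mul, norm_mul, norm_mul, Complex.norm_real, Real.norm_eq_abs, add_mul]
  refine add_le_add ?_ ?_
  · rw [mul_comm]
    refine mul_le_mul (hM₁ z hzb) ?_ (norm_nonneg _) hM₁₀
    exact hxx.le.trans (mul_le_of_le_one_left hx0 hx1)
  · calc |γ| * ‖Complex.log z‖ * (‖z‖ * ‖v₂ z‖)
        = |γ| * (‖v₂ z‖ * (‖Complex.log z‖ * x)) * x := by rw [hxx]; ring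
      _ ≤ |γ| * (M₂ * (2 + π)) * x := by
        refine mul_le_mul_of_nonneg_right ?_ hx0
        refine mul_le_mul_of_nonneg_left ?_ (abs_nonneg _)
        exact mul_le_mul (hM₂ z hzb) hlog (by positivity) hM₂₀

/-- Approximate solutions of `w = weightedMean (abelKernel a) (p + q w)`, so good that successive
approximations starting there converge. -/
theorem exists_approximate_solution (ha₀ : 0 < a) (ha₁ : a < 1) {ρ : ℝ} (hρ : 0 < ρ)
    (hρ₁ : ρ ≤ 1) {p q : ℂ → ℂ}
    (hp : IsAdmissible ρ (Metric.closedBall 0 ρ) (Metric.ball 0 ρ) p)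
    (hq : IsAdmissible ρ (Metric.closedBall 0 ρ) (Metric.ball 0 ρ) q) (hp₀ : p 0 = 0) :
    ∃ w₀ C σ, IsAdmissible ρ (insert 0 (closedCutDisc ρ)) (cutDisc ρ) w₀ ∧ w₀ 0 = 0 ∧ 0 ≤ C ∧
      0 < σ ∧ ‖q 0‖ * abelMoment a σ < 1 ∧
      ∀ z ∈ insert 0 (closedCutDisc ρ),
        ‖weightedMean (abelKernel a) (fun z => p z + q z * w₀ z) z - w₀ z‖ ≤ C * ‖z‖ ^ σ := by
  have hq0 : q 0 = ((q 0).re : ℂ) := Complex.ext (by simp) (by simp [hq.im_zero_eq_zero hρ])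
  have hqn : ‖q 0‖ = |(q 0).re| := by
    conv_lhs => rw [hq0]
    simp
  by_cases hres : ∃ j : ℕ, 1 ≤ j ∧ (q 0).re * abelMoment a j = 1
  · obtain ⟨j, hj, hjr⟩ := hres
    have hj0 : (0 : ℝ) ≤ j := j.cast_nonneg
    have hκ : 0 < (q 0).re := by
      have := abelMoment_pos ha₀ ha₁ hj0
      by_contra h
      nlinarith
    obtain ⟨P, r, hP, hr, hP0, hPr⟩ := exists_approximate_solution_pow ha₀ ha₁ hρ hp hq hp₀ hj
      (fun i _ hij h => by
        have := abelMoment_lt ha₀ ha₁ (Nat.cast_nonneg (α := ℝ) i)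
          (show (i : ℝ) < j by exact_mod_cast hij)
        nlinarith)
    obtain ⟨w₀, C, hw₀, hw₀0, hC, hle⟩ :=
      exists_approximate_solution_log ha₀ ha₁ hρ hρ₁ hp hq hP hr hP0 hj hPr hjr
    -- Since `q(0) Λ_j = 1`, the half order beyond `j` already suffices for contraction.
    refine ⟨w₀, C, (j : ℝ) + 1 / 2, hw₀, hw₀0, hC, by positivity, ?_, hle⟩
    rw [hqn, abs_of_pos hκ]
    have := abelMoment_lt ha₀ ha₁ hj0 (show (j : ℝ) < j + 1 / 2 by linarith)
    nlinarith
  · push Not at hres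
    -- Without resonance the polynomial construction runs up to an order `k` with `|q(0)| Λ_k < 1`.
    have ht := (tendsto_abelMoment ha₀ ha₁).const_mul ‖q 0‖
    rw [mul_zero] at ht
    obtain ⟨k, hk1, hk⟩ := ((ht.eventually (gt_mem_nhds zero_lt_one)).and
      (eventually_ge_atTop 1)).exists
    obtain ⟨P, r, hP, hr, hP0, hPr⟩ := exists_approximate_solution_pow ha₀ ha₁ hρ hp hq hp₀ hk
      (fun i hi _ => hres i hi)
    obtain ⟨M, hM₀, hM⟩ := hr.exists_norm_le
    have hsub := insert_closedCutDisc_subset hρ.le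
    refine ⟨P, M, k, hP.mono hsub inter_subset_left, hP0, hM₀, by positivity, hk1,
      fun z hz => ?_⟩
    rw [norm_sub_rev, hPr z (hsub hz), norm_mul, norm_pow, rpow_natCast, mul_comm]
    exact mul_le_mul_of_nonneg_right (hM z (hsub hz)) (by positivity)

variable {b : ℝ} {F N : ℂ → ℂ → ℂ}

/-- If the right-hand side grows at most linearly, then there is a solution on the cut disc. -/
theorem IsReducedRHS.exists_solution_of_linear_growth (hN : IsReducedRHS a b F N) (ha₀ : 0 < a)
    (ha₁ : a < 1) {c : ℝ} {g : ℂ → ℂ} (hg₀ : g 0 = 0)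
    (hle : ∀ z ∈ Metric.ball (0 : ℂ) 1, ∀ t, ‖N z t‖ ≤ c * ‖t‖ + ‖g z‖) :
    ∃ R w M, 0 < R ∧ R < 1 ∧
      IsAdmissible R (insert 0 (closedCutDisc R)) (cutDisc R) w ∧ w 0 = 0 ∧
      (∀ z ∈ insert 0 (closedCutDisc R), ‖N z (w z)‖ ≤ M) ∧
      ∀ z ∈ insert 0 (closedCutDisc R),
        w z = weightedMean (abelKernel a) (fun z => N z (w z)) z := by
  set p : ℂ → ℂ := fun z => N z ((0 : ℝ) : ℂ) with hp
  set q : ℂ → ℂ := fun z => N z ((1 : ℝ) : ℂ) - N z ((0 : ℝ) : ℂ) with hq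
  have haff : ∀ z ∈ Metric.ball (0 : ℂ) 1, ∀ t, N z t = p z + q z * t := by
    intro z hz t
    have hd : Differentiable ℂ fun t => N z t := fun t =>
      (hN.analytic (z, t) ⟨hz, mem_univ _⟩).differentiableAt.comp (f := fun t : ℂ => (z, t)) t
        (by fun_prop)
    have := hd.eq_affine_of_norm_le (hle z hz) t
    simpa [hp, hq] using this
  -- A radius below `1` makes `p` and `q` continuous up to the boundary, since `N` is controlled
  -- only over the open unit disc.
  have hDb := isStarPair_ball (1 / 2)
  have hhalf : (1 / 2 : ℝ) < 1 := by norm_num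
  have hpa := hN.isAdmissible hDb hhalf (IsAdmissible.const 0)
  have hqa := (hN.isAdmissible hDb hhalf (IsAdmissible.const 1)).sub hpa
  have hp₀ : p 0 = 0 := by
    have := hle 0 (by simp) 0
    simpa [hp, hg₀] using this
  obtain ⟨w₀, C, σ, hw₀, hw₀0, hC, hσ, hθ, hres⟩ :=
    exists_approximate_solution ha₀ ha₁ (by norm_num) hhalf.le hpa hqa hp₀
  have hΛ := abelMoment_pos ha₀ ha₁ hσ.le
  obtain ⟨L, hqL, hL⟩ : ∃ L, ‖q 0‖ < L ∧ L < 1 / abelMoment a σ :=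
    exists_between (by rwa [lt_div_iff₀ hΛ])
  rw [lt_div_iff₀ hΛ] at hL
  have hL₀ : 0 ≤ L := (norm_nonneg _).trans hqL.le
  have h1θ : 0 < 1 - L * abelMoment a σ := by linarith
  obtain ⟨M, hM₀, hM⟩ := hpa.exists_norm_le
  have hqc : ContinuousAt q 0 := hqa.continuousOn.continuousAt
    (Metric.closedBall_mem_nhds _ (by norm_num))
  obtain ⟨δ, hδ, hδq⟩ := Metric.eventually_nhds_iff.1
    (hqc.norm.eventually (gt_mem_nhds hqL))
  have hw₀c : ContinuousWithinAt w₀ (insert 0 (closedCutDisc (1 / 2))) 0 :=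
    hw₀.continuousOn 0 (mem_insert _ _)
  have hw₀n := hw₀c.norm.tendsto
  rw [hw₀0, norm_zero] at hw₀n
  obtain ⟨δ', hδ', hδw⟩ := Metric.mem_nhdsWithin_iff.1
    (hw₀n.eventually (gt_mem_nhds (show (0 : ℝ) < 1 / 2 by norm_num)))
  have hev := eventually_mul_rpow_le (C / (1 - L * abelMoment a σ)) σ (1 / 2) hσ
    (by norm_num)
  have hev' : ∀ᶠ R in 𝓝[>] (0 : ℝ), R < min (1 / 2) (min δ δ') :=
    nhdsWithin_le_nhds (gt_mem_nhds (by positivity))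
  obtain ⟨R, hR₁, hR₂, hR₀⟩ := (hev.and (hev'.and self_mem_nhdsWithin)).exists
  simp only [lt_min_iff] at hR₂
  have hR₀' : (0 : ℝ) < R := hR₀
  have hR1 : R < 1 := hR₂.1.trans hhalf
  have hD := isStarPair_cutDisc hR₀'
  have hnorm : ∀ z ∈ insert 0 (closedCutDisc R), ‖z‖ ≤ R := fun z hz =>
    mem_closedBall_zero_iff.1 (hD.subset_closedBall hz)
  have hball : ∀ z ∈ insert 0 (closedCutDisc R), z ∈ Metric.ball (0 : ℂ) 1 := fun z hz =>
    hD.subset_ball hR1 hz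
  have hhalfball : ∀ z ∈ insert 0 (closedCutDisc R), z ∈ Metric.closedBall (0 : ℂ) (1 / 2) :=
    fun z hz => mem_closedBall_zero_iff.2 ((hnorm z hz).trans hR₂.1.le)
  have hsub : insert 0 (closedCutDisc R) ⊆ insert 0 (closedCutDisc (1 / 2)) :=
    insert_subset_insert (inter_subset_inter_left _ (Metric.closedBall_subset_closedBall hR₂.1.le))
  have hsub' : cutDisc R ⊆ cutDisc (1 / 2) :=
    inter_subset_inter_left _ (Metric.ball_subset_ball hR₂.1.le)
  have hqz : ∀ z ∈ insert 0 (closedCutDisc R), ‖q z‖ ≤ L := fun z hz =>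
    (@hδq z (by simpa using (hnorm z hz).trans_lt hR₂.2.1)).le
  have hMz : ∀ z ∈ insert 0 (closedCutDisc R), ∀ t, ‖t‖ ≤ 1 → ‖N z t‖ ≤ M + L * 1 :=
    fun z hz t ht => by
      rw [haff z (hball z hz)]
      refine (norm_add_le _ _).trans (add_le_add (hM z (hhalfball z hz)) ?_)
      rw [norm_mul]
      exact mul_le_mul (hqz z hz) ht (norm_nonneg _) hL₀
  obtain ⟨w, hw, hwr, hwN, hw0⟩ := exists_eq_weightedMean ha₀ ha₁ hD
    (fun x hx hxR => Or.inr ⟨by simpa [abs_of_pos hx] using hxR, Or.inl (by simpa using hx)⟩)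
    (N := N) (r := 1) (L := L) (M := M + L * 1) (σ := σ) (C := C)
    (fun w hw _ => hN.isAdmissible hD hR1 hw) hMz hL₀
    (fun z hz t t' _ _ => by
      rw [haff z (hball z hz), haff z (hball z hz), add_sub_add_left_eq_sub, ← mul_sub, norm_mul]
      exact mul_le_mul_of_nonneg_right (hqz z hz) (norm_nonneg _)) hσ hL
    (w₀ := w₀) ((hw₀.mono hsub hsub').restrict hR₂.1.le)
    (fun z hz => (hδw ⟨by simpa using (hnorm z hz).trans_lt hR₂.2.2, hsub hz⟩ : ‖w₀ z‖ < 1 / 2).le)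
    hC (fun z hz => by
      rw [weightedMean_congr (h₂ := fun z => p z + q z * w₀ z) fun s hs =>
        haff _ (hball _ (hD.mul_mem z hz s (Ioc_subset_Icc_self hs))) _]
      exact hres z (hsub hz))
    (by rw [div_mul_eq_mul_div] at hR₁; exact hR₁)
  exact ⟨R, w, _, hR₀', hR1, hw, by rw [hw0 (mem_insert _ _), hw₀0],
    fun z hz => hMz z hz _ (hwr z hz), hwN⟩

end

/-! ### The main theorem. -/

theorem theorem3p14 (a b : ℝ) (ha₀ : 0 < a) (ha₁ : a < 1)
    (f : ℝ → ℝ → ℝ) (F : ℂ → ℂ → ℂ)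
    (hF : RegularRHS a F)
    (hfF : ∀ x ∈ Set.Ioc (0 : ℝ) 1, ∀ y : ℝ, F (x : ℂ) (y : ℂ) = ((f x y : ℝ) : ℂ))
    (n₀ : ℕ) (hn₀ : 1 ≤ n₀) (c : ℝ) (hc : 0 ≤ c)
    (g : ℂ → ℂ) (hg : MemDiscSpace 1 g) (hg₀ : g 0 = 0)
    (hbound : GrowthBound a b F n₀ c g) :
    ∃ R₀ : ℝ, 0 < R₀ ∧ R₀ ≤ 1 ∧ ∃ u : ℂ → ℂ,
      IsRealSolution a b f R₀ (fun x : ℝ => (u (x : ℂ)).re) ∧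
      IsComplexSolution a (b : ℂ) F R₀ u ∧
      (2 ≤ n₀ ∨ c * Real.Gamma (2 - a) < 1 → MemDiscSpace R₀ u) := by
  obtain ⟨N, hN, hle⟩ := hF.exists_isReducedRHS hfF hg hbound
  have hle₀ : ∀ t, ‖N 0 t‖ ≤ c * ‖t‖ ^ n₀ := fun t => by
    simpa [hg₀] using hle 0 (by simp) t
  by_cases hcase : 2 ≤ n₀ ∨ c * Real.Gamma (2 - a) < 1
  · have hΓ : 0 < Gamma (2 - a) := Gamma_pos_of_pos (by linarith)
    obtain ⟨κ, hκ₀, hκ, hκN⟩ : ∃ κ, 0 ≤ κ ∧ κ * Gamma (2 - a) < 1 ∧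
        ∀ᶠ t in 𝓝 (0 : ℂ), ‖N 0 t‖ ≤ κ * ‖t‖ := by
      have h1 : ∀ᶠ t in 𝓝 (0 : ℂ), ‖t‖ ≤ 1 := by
        filter_upwards [Metric.closedBall_mem_nhds (0 : ℂ) one_pos] with t ht
        simpa using ht
      rcases hcase with h2 | h2
      -- For `n₀ ≥ 2` the bound `c |t|^n₀` is `o(|t|)`, so any positive `κ` below `1/Γ(2-a)` would
      -- do.
      · refine ⟨1 / (2 * Gamma (2 - a)), by positivity, ?_, ?_⟩
        · field_simp; norm_num
        have h3 : ∀ᶠ t in 𝓝 (0 : ℂ), c * ‖t‖ < 1 / (2 * Gamma (2 - a)) := by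
          have : Tendsto (fun t : ℂ => c * ‖t‖) (𝓝 0) (𝓝 (c * ‖(0 : ℂ)‖)) :=
            (continuous_const.mul continuous_norm).tendsto 0
          rw [norm_zero, mul_zero] at this
          exact this.eventually (gt_mem_nhds (by positivity))
        filter_upwards [h1, h3] with t ht ht'
        have h4 : ‖t‖ ^ n₀ ≤ ‖t‖ ^ 2 := pow_le_pow_of_le_one (norm_nonneg _) ht h2
        calc ‖N 0 t‖ ≤ c * ‖t‖ ^ 2 := (hle₀ t).trans (mul_le_mul_of_nonneg_left h4 hc)
          _ = c * ‖t‖ * ‖t‖ := by ring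
          _ ≤ _ := mul_le_mul_of_nonneg_right ht'.le (norm_nonneg _)
      · refine ⟨c, hc, h2, ?_⟩
        filter_upwards [h1] with t ht
        exact (hle₀ t).trans (mul_le_mul_of_nonneg_left
          (pow_le_of_le_one (norm_nonneg _) ht (by omega)) hc)
    obtain ⟨R, w, M, hR, hR₁, hw, hw₀, hM, hwN⟩ := hN.exists_analytic_solution ha₀ ha₁ hκ₀ hκ hκN
    have hsub := insert_closedCutDisc_subset hR.le
    obtain ⟨h1, h2⟩ := hN.isSolution ha₀ ha₁ hfF hR hR₁ (hw.mono hsub inter_subset_left) hw₀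
      (fun z hz => hM z (hsub hz)) fun z hz => hwN z (hsub hz)
    refine ⟨R, hR, hR₁.le, fun z => (b : ℂ) + w z, h1, h2, fun _ => ?_⟩
    refine ⟨hw.differentiableOn.const_add _, ?_⟩
    rw [closure_ball _ hR.ne']
    exact continuousOn_const.add hw.continuousOn
  -- Here the condition of the last clause fails, so that a solution on the cut disc is all that is
  -- asked.
  · have hn : n₀ = 1 := by
      by_contra h
      exact hcase (Or.inl (by omega))
    subst hn
    simp only [pow_one] at hle
    obtain ⟨R, w, M, hR, hR₁, hw, hw₀, hM, hwN⟩ :=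
      hN.exists_solution_of_linear_growth ha₀ ha₁ hg₀ hle
    obtain ⟨h1, h2⟩ := hN.isSolution ha₀ ha₁ hfF hR hR₁ hw hw₀ hM hwN
    exact ⟨R, hR, hR₁.le, fun z => (b : ℂ) + w z, h1, h2, fun h => absurd h hcase⟩
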